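/- Let $A\in\mathbb{R}^{n\times n}$ be skew-symmetric and invertible and let $b\in\mathbb{R}^{n\times 1}$ be such that $(A,b)$ is stabilizable, i.e. $A+bK$ is Hurwitz for some $K\in\mathbb{R}^{1\times n}$. Consider the system $$\dot x=Ax+bu,\qquad y=\tfrac12|x|^2,$$ with state $x\in\mathbb{R}^n$, scalar control $u$ and scalar output $y$. An equilibrium is called asymptotically stable if it is Lyapunov stable and its basin of attraction is a neighbourhood of it; here the basin is the set of initial conditions from which a solution exists and every maximal solution is defined for all $t\ge0$ and converges to the equilibrium. (1) The system is semi-globally stabilizable by means of a finite-dimensional dynamic output feedback: for every compact set $\mathcal K\subset\mathbb{R}^n$ there exist a positive integer $q$, continuous maps $\nu:\mathbb{R}^q\times\mathbb{R}\times\mathbb{R}\to\mathbb{R}^q$ and $\varpi:\mathbb{R}^q\times\mathbb{R}\to\mathbb{R}$ with $\varpi(0,0)=0$, and a non-empty compact set $\widehat{\mathcal K}\subset\mathbb{R}^q$ such that $(0,0)\in\mathbb{R}^n\times\mathbb{R}^q$ is an asymptotically stable equilibrium of $$\dot x=Ax+bu,\quad y=\tfrac12|x|^2,\quad \dot w=\nu(w,u,y),\quad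 u=\varpi(w,y),$$ with basin of attraction containing $\mathcal K\times\widehat{\mathcal K}$. (2) Explicitly, let $K\in\mathbb{R}^{1\times n}$ be any row vector such that $A+bK$ is Hurwitz, and for $u\in\mathbb{R}$ and $\alpha>0$ set $$\mathcal A(u)=\begin{pmatrix}A&0\\ ub'&0\end{pmatrix},\quad \mathcal B=\begin{pmatrix}b\\0\end{pmatrix},\quad \mathcal C=\begin{pmatrix}0&\cdots&0&1\end{pmatrix},\quad \mathcal L_\alpha(u)=\begin{pmatrix}bu\\ \alpha\end{pmatrix}.$$ Then for all compact sets $\mathcal K\subset\mathbb{R}^n$ and $\widehat{\mathcal K}\subset\mathbb{R}^{n+1}$ there exist $\delta_0>0$ and $\alpha_0>0$ such that for all $\delta\in(0,\delta_0)$ and all $\alpha\in(\alpha_0,+\infty)$, $(0,0)\in\mathbb{R}^n\times\mathbb{R}^{n+1}$ is an asymptotically stable equilibrium of $$\dot x=Ax+bu,\quad y=\tfrac12|x|^2,\quad \dot{\hat z}=\mathcal A(u)\hat z+\mathcal B u-\mathcal L_\alpha(u)(\mathcal C\hat z-y),\quad u=\begin{pmatrix}K&\delta\end{pmatrix}\hat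 z,$$ with basin of attraction containing $\mathcal K\times\widehat{\mathcal K}$. -/

import Mathlib

open Set Filter Topology

noncomputable section

namespace OutputStab

/-! ### Asymptotic stability of the origin for an autonomous vector field -/

section Stability

variable {E : Type*} [NormedAddCommGroup E] [NormedSpace ℝ E]

/-- `γ` solves `γ' = F(γ)` on `[0, T)`. -/
def IsSolutionOn (F : E → E) (γ : ℝ → E) (T : ℝ) : Prop :=
  IsIntegralCurveOn γ (fun _ => F) (Ico 0 T)

/-- `γ` solves `γ' = F(γ)` on `[0, ∞)`. -/
def IsGlobalSolution (F : E → E) (γ : ℝ → E) : Prop :=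
  IsIntegralCurveOn γ (fun _ => F) (Ici 0)

/-- Lyapunov stability of the origin: every solution that starts near `0` remains near `0` as long
as it exists. -/
def IsLyapunovStable (F : E → E) : Prop :=
  ∀ ε > 0, ∃ r > 0, ∀ (γ : ℝ → E) (T : ℝ), IsSolutionOn F γ T → ‖γ 0‖ < r →
    ∀ t ∈ Ico 0 T, ‖γ t‖ < ε

/-- The basin of attraction of the origin: the initial conditions `p` from which a global solution
exists, from which every solution on some `[0, T)` continues to a global one (that is, every
maximal solution is global), and from which every global solution tends to `0`. For a vector field
that is only continuous, solutions need not be unique. -/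
def basin (F : E → E) : Set E :=
  {p | (∃ γ : ℝ → E, IsGlobalSolution F γ ∧ γ 0 = p) ∧
    (∀ (γ : ℝ → E) (T : ℝ), 0 < T → IsSolutionOn F γ T → γ 0 = p →
      ∃ γ' : ℝ → E, IsGlobalSolution F γ' ∧ EqOn γ γ' (Ico 0 T)) ∧
    (∀ γ : ℝ → E, IsGlobalSolution F γ → γ 0 = p → Tendsto γ atTop (𝓝 0))}

/-- The origin is a (locally) asymptotically stable equilibrium of `F`. -/
def IsAsymptoticallyStable (F : E → E) : Prop :=
  F 0 = 0 ∧ IsLyapunovStable F ∧ basin F ∈ 𝓝 0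

end Stability

/-! ### Dynamic output feedback -/

section Feedback

variable {X U Y W : Type*}

/-- The closed loop of `x' = f(x, u)`, `y = h(x)` with `w' = ν(w, u, y)`, `u = ϖ(w, y)`. -/
def closedLoop (f : X → U → X) (h : X → Y) (ν : W → U → Y → W) (ϖ : W → Y → U) :
    X × W → X × W :=
  fun p => (f p.1 (ϖ p.2 (h p.1)), ν p.2 (ϖ p.2 (h p.1)) (h p.1))

/-- Semi-global stabilizability by means of a (finite-dimensional, time-independent, continuous)
dynamic output feedback; `ϖ(0, 0) = 0` is the usual normalization of the control at the target. -/
def IsSemiGloballyStabilizable [NormedAddCommGroup X] [NormedSpace ℝ X]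
    [NormedAddCommGroup U] [NormedAddCommGroup Y] (f : X → U → X) (h : X → Y) : Prop :=
  ∀ 𝒦 : Set X, IsCompact 𝒦 →
    ∃ q : ℕ, 0 < q ∧
      ∃ (ν : EuclideanSpace ℝ (Fin q) → U → Y → EuclideanSpace ℝ (Fin q))
        (ϖ : EuclideanSpace ℝ (Fin q) → Y → U) (𝒦' : Set (EuclideanSpace ℝ (Fin q))),
        Continuous (fun a : EuclideanSpace ℝ (Fin q) × U × Y => ν a.1 a.2.1 a.2.2) ∧
        Continuous (fun a : EuclideanSpace ℝ (Fin q) × Y => ϖ a.1 a.2) ∧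
        ϖ 0 0 = 0 ∧ IsCompact 𝒦' ∧ 𝒦'.Nonempty ∧
        IsAsymptoticallyStable (closedLoop f h ν ϖ) ∧
        𝒦 ×ˢ 𝒦' ⊆ basin (closedLoop f h ν ϖ)

end Feedback

/-! ### The linear system with quadratic output, and its observer -/

/-- All complex eigenvalues have negative real part. -/
def IsHurwitz {n : ℕ} (M : Matrix (Fin n) (Fin n) ℝ) : Prop :=
  ∀ μ ∈ spectrum ℂ (M.map (algebraMap ℝ ℂ)), μ.re < 0

/-- `(A, b)` is stabilizable: `A + bK` is Hurwitz for some row vector `K`. -/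
def IsStabilizablePair {n : ℕ} (A : Matrix (Fin n) (Fin n) ℝ) (b : Fin n → ℝ) : Prop :=
  ∃ K : Fin n → ℝ, IsHurwitz (A + Matrix.vecMulVec b K)

/-- The dynamics `(x, u) ↦ Ax + bu`. -/
def linSys {n : ℕ} (A : Matrix (Fin n) (Fin n) ℝ) (b : Fin n → ℝ)
    (x : EuclideanSpace ℝ (Fin n)) (u : ℝ) : EuclideanSpace ℝ (Fin n) :=
  WithLp.toLp 2 (A.mulVec x.ofLp + u • b)

/-- The output `y = |x|² / 2`. -/
def halfSq {n : ℕ} (x : EuclideanSpace ℝ (Fin n)) : ℝ := ‖x‖ ^ 2 / 2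

/-- Append one last entry to a tuple. -/
def appendLast {n : ℕ} {α : Type*} (v : Fin n → α) (a : α) : Fin (n + 1) → α :=
  Fin.snoc (α := fun _ => α) v a

/-- The block matrix `𝒜(u) = [[A, 0], [u bᵀ, 0]]`. -/
def bilinMat {n : ℕ} (A : Matrix (Fin n) (Fin n) ℝ) (b : Fin n → ℝ) (u : ℝ) :
    Matrix (Fin (n + 1)) (Fin (n + 1)) ℝ :=
  Matrix.of (appendLast (fun i => appendLast (A i) 0) (appendLast (u • b) 0))

/-- The Luenberger observer of the bilinear system `z' = 𝒜(u)z + ℬu`, `y = 𝒞z`, where `ℬ = (b, 0)`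
and `𝒞 = (0, …, 0, 1)`, with gain `ℒ_α(u) = (bu, α)`:
`w' = 𝒜(u)w + ℬu - ℒ_α(u)(𝒞w - y)`. -/
def observer {n : ℕ} (A : Matrix (Fin n) (Fin n) ℝ) (b : Fin n → ℝ) (α : ℝ)
    (w : EuclideanSpace ℝ (Fin (n + 1))) (u y : ℝ) : EuclideanSpace ℝ (Fin (n + 1)) :=
  WithLp.toLp 2 ((bilinMat A b u).mulVec w.ofLp + u • appendLast b 0
    - (w (Fin.last n) - y) • appendLast (u • b) α)

/-- The perturbed feedback law `λ_δ(w) = (K δ)w`; it does not use the output directly. -/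
def feedback {n : ℕ} (K : Fin n → ℝ) (δ : ℝ) (w : EuclideanSpace ℝ (Fin (n + 1))) (_y : ℝ) : ℝ :=
  appendLast K δ ⬝ᵥ w.ofLp

end OutputStab

end

/-! Write ε = x̂ - x and ε_y = ŷ - y for the estimation errors. Since A is skew, y' = u b'x, so ε' =
Aε - u ε_y b and ε_y' = u b'ε - α ε_y. The coupling is skew too, hence the error energy |ε|² + ε_y²
has derivative -2α ε_y² and never increases, whatever the control.

The estimate obeys x̂' = (A + bK)x̂ + (δŷ - u ε_y)b, and A + bK has a quadratic Lyapunov function V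
= ‖J x̂‖². On a bounded region the disturbance δŷ is small with δ. The disturbance u ε_y need not be
small at each instant, but its square is paid for by the loss of error energy: adding a multiple D/α
of that energy to V cancels it, and for large α the addition is negligible on the given compact set.
This barrier bounds all trajectories and yields V' ≤ -κV + C·(error energy)
(`exists_uniform_dissipation`).

It remains to see that the error energy tends to 0, by LaSalle's principle. On a limit trajectory it
is constant, so ε_y = 0, hence u b'ε = 0 and ε' = Aε. If b'ε = 0 throughout, observability of (b',
A) gives ε = 0. Otherwise u = 0 on an interval. There x̂' = Ax̂ and ŷ is constant, so KAx̂ = 0;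
observability of (K, A) and invertibility of A give x̂ = 0, and δ > 0 forces ŷ = 0. Then y = 0, x =
0, and ε = 0 after all (`IsObserverLoop.errorEnergy_eq_zero_of_const`). The perturbation δ thus
removes the singular control u = 0 away from the target.

Both observability properties follow from Lyapunov forms: on an A-invariant subspace of ker K the
flow of A would strictly decrease V, which a skew A cannot do (`submodule_eq_bot_of_skew`). For b'
the same is applied to the transpose of A + bK. -/

namespace OutputStab

/-! ### Existence, uniqueness and limits of trajectories. -/

section ODE

variable {E : Type*} [NormedAddCommGroup E] [NormedSpace ℝ E]

lemma IsSolutionOn.hasDerivWithinAt_Ici {F : E → E} {γ : ℝ → E} {T t : ℝ}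
    (h : IsSolutionOn F γ T) (ht : t ∈ Ico 0 T) : HasDerivWithinAt γ (F (γ t)) (Ici t) t := by
  refine (h t ht).mono_of_mem_nhdsWithin ?_
  exact mem_of_superset (Ico_mem_nhdsGE ht.2) (Ico_subset_Ico_left ht.1)

lemma IsSolutionOn.mono {F : E → E} {γ : ℝ → E} {T T' : ℝ}
    (h : IsSolutionOn F γ T) (hT : T' ≤ T) : IsSolutionOn F γ T' :=
  IsIntegralCurveOn.mono h (Ico_subset_Ico_right hT)

lemma IsGlobalSolution.isSolutionOn {F : E → E} {γ : ℝ → E}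
    (h : IsGlobalSolution F γ) (T : ℝ) : IsSolutionOn F γ T :=
  IsIntegralCurveOn.mono h Ico_subset_Ici_self

lemma IsGlobalSolution.hasDerivAt {F : E → E} {γ : ℝ → E} {t : ℝ}
    (h : IsGlobalSolution F γ) (ht : 0 < t) : HasDerivAt γ (F (γ t)) t :=
  (h t ht.le).hasDerivAt (Ici_mem_nhds ht)

lemma isGlobalSolution_of_forall {F : E → E} {γ : ℝ → E}
    (h : ∀ T, IsSolutionOn F γ T) : IsGlobalSolution F γ := by
  intro t ht
  have ht : 0 ≤ t := ht
  refine (h (t + 1) t ⟨ht, by linarith⟩).mono_of_mem_nhdsWithin ?_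
  rw [← Ici_inter_Iio, inter_comm]
  exact inter_mem (mem_nhdsWithin_of_mem_nhds (Iio_mem_nhds (by linarith))) self_mem_nhdsWithin

lemma IsSolutionOn.congr {F F' : E → E} {γ : ℝ → E} {T : ℝ}
    (h : IsSolutionOn F γ T) (hF : ∀ t ∈ Ico 0 T, F (γ t) = F' (γ t)) : IsSolutionOn F' γ T :=
  fun t ht => by simpa [hF t ht] using h t ht

lemma IsSolutionOn.congr_curve {F : E → E} {γ γ' : ℝ → E} {T : ℝ}
    (h : IsSolutionOn F γ T) (hγ : EqOn γ' γ (Ico 0 T)) : IsSolutionOn F γ' T := by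
  intro t ht
  have := (h t ht).congr hγ (hγ ht)
  simpa [hγ ht] using this

lemma IsSolutionOn.dist_le {F : E → E} {K : NNReal} (hF : LipschitzWith K F)
    {γ σ : ℝ → E} {T : ℝ} (hγ : IsSolutionOn F γ T) (hσ : IsSolutionOn F σ T) {t : ℝ}
    (ht : t ∈ Ico 0 T) : dist (γ t) (σ t) ≤ dist (γ 0) (σ 0) * Real.exp (K * t) := by
  have hsub : Icc 0 t ⊆ Ico 0 T := fun s hs => ⟨hs.1, hs.2.trans_lt ht.2⟩
  have hsub' : Ico 0 t ⊆ Ico 0 T := Ico_subset_Icc_self.trans hsub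
  have := dist_le_of_trajectories_ODE (v := fun _ => F) (K := K) (a := 0) (b := t)
    (δ := dist (γ 0) (σ 0)) (fun _ => hF)
    (IsIntegralCurveOn.continuousOn hγ |>.mono hsub)
    (fun s hs => hγ.hasDerivWithinAt_Ici (hsub' hs))
    (IsIntegralCurveOn.continuousOn hσ |>.mono hsub)
    (fun s hs => hσ.hasDerivWithinAt_Ici (hsub' hs)) le_rfl t ⟨ht.1, le_rfl⟩
  simpa using this

lemma IsSolutionOn.eqOn {F : E → E} {K : NNReal} (hF : LipschitzWith K F)
    {γ σ : ℝ → E} {T : ℝ} (hγ : IsSolutionOn F γ T) (hσ : IsSolutionOn F σ T)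
    (h0 : γ 0 = σ 0) : EqOn γ σ (Ico 0 T) := by
  intro t ht
  have := hγ.dist_le hF hσ ht
  rw [h0, dist_self, zero_mul] at this
  exact dist_le_zero.1 this

/-- A bounded Lipschitz vector field is forward complete. -/
lemma exists_isGlobalSolution_of_lipschitz [CompleteSpace E] {F : E → E} {K L : NNReal}
    (hF : LipschitzWith K F) (hL : ∀ x, ‖F x‖ ≤ L) (p : E) :
    ∃ γ : ℝ → E, IsGlobalSolution F γ ∧ γ 0 = p := by
  have key : ∀ N : ℕ, ∃ α : ℝ → E, α 0 = p ∧ IsSolutionOn F α (N + 1) := by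
    intro N
    have hN : (0 : ℝ) ≤ N + 1 := by positivity
    have hpl : IsPicardLindelof (fun _ => F) (tmin := 0) (tmax := N + 1) ⟨0, le_rfl, hN⟩ p
        (L * (N + 1)) 0 L K := by
      refine IsPicardLindelof.of_time_independent (fun x _ => hL x) hF.lipschitzOnWith ?_
      simp [hN]
    obtain ⟨α, h0, hα⟩ := hpl.exists_eq_forall_mem_Icc_hasDerivWithinAt₀
    exact ⟨α, h0, fun t ht => (hα t (Ico_subset_Icc_self ht)).mono Ico_subset_Icc_self⟩
  choose α hα0 hα using key
  have agree : ∀ M N : ℕ, M ≤ N → EqOn (α M) (α N) (Ico 0 (M + 1)) := fun M N hMN =>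
    (hα M).eqOn hF ((hα N).mono (by simpa using hMN)) (by rw [hα0, hα0])
  -- The solution with index N lives on [0, N + 1), so index ⌊t⌋ is defined at t; by uniqueness the
  -- choices agree.
  refine ⟨fun t => α ⌊t⌋₊ t, isGlobalSolution_of_forall fun T => ?_, by simp [hα0]⟩
  refine ((hα ⌈T⌉₊).mono ((Nat.le_ceil T).trans (by simp))).congr_curve fun t ht => ?_
  refine agree _ _ ?_ ⟨ht.1, Nat.lt_floor_add_one t⟩
  exact (Nat.floor_le_floor ht.2.le).trans (Nat.floor_le_ceil T)

variable [FiniteDimensional ℝ E]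

/-- Multiplying by a smooth bump equal to 1 on the ball gives a compactly supported C¹ field, hence
one that is bounded and globally Lipschitz. -/
lemma exists_lipschitz_truncation {F : E → E} (hF : ContDiff ℝ 1 F) (R : ℝ) :
    ∃ (F' : E → E) (K L : NNReal), LipschitzWith K F' ∧ (∀ x, ‖F' x‖ ≤ L) ∧
      ∀ x, ‖x‖ ≤ R → F' x = F x := by
  have hR : 0 < |R| + 1 := by positivity
  let χ : ContDiffBump (0 : E) := ⟨|R| + 1, |R| + 2, hR, by linarith⟩
  have hc : ContDiff ℝ 1 fun x => χ x • F x := χ.contDiff.smul hF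
  have hs : HasCompactSupport fun x => χ x • F x := χ.hasCompactSupport.smul_right
  obtain ⟨K, hK⟩ := hc.lipschitzWith_of_hasCompactSupport hs one_ne_zero
  obtain ⟨C, hC⟩ := hs.exists_bound_of_continuous hc.continuous
  refine ⟨_, K, C.toNNReal, hK, fun x => (hC x).trans (Real.le_coe_toNNReal C), fun x hx => ?_⟩
  have : χ x = 1 := χ.one_of_mem_closedBall (by
    rw [mem_closedBall_zero_iff]; exact hx.trans ((le_abs_self R).trans (by simp [χ])))
  simp [this]

/-- An a priori bound on all solutions starting at `p` yields completeness and uniqueness. -/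
lemma isGlobal_of_bounded {F : E → E} (hF : ContDiff ℝ 1 F) {p : E} {R : ℝ}
    (hR : ∀ (γ : ℝ → E) (T : ℝ), IsSolutionOn F γ T → γ 0 = p → ∀ t ∈ Ico 0 T, ‖γ t‖ ≤ R) :
    ∃ γ : ℝ → E, IsGlobalSolution F γ ∧ γ 0 = p ∧
      ∀ (σ : ℝ → E) (T : ℝ), 0 < T → IsSolutionOn F σ T → σ 0 = p → EqOn σ γ (Ico 0 T) := by
  wlog hpR : ‖p‖ ≤ R generalizing R
  · exact this (R := max R ‖p‖) (fun γ T hγ h0 t ht => (hR γ T hγ h0 t ht).trans (le_max_left _ _))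
      (le_max_right _ _)
  -- The unit margin is for the exit argument: up to its first time at norm R + 1 the truncated
  -- solution solves the true equation, so by continuity its norm is at most R at that time.
  obtain ⟨F', K, L, hK, hL, hFF'⟩ := exists_lipschitz_truncation hF (R + 1)
  obtain ⟨γ, hγ, h0⟩ := exists_isGlobalSolution_of_lipschitz hK hL p
  have hcont : ContinuousOn (fun t => ‖γ t‖) (Ici 0) :=
    (IsIntegralCurveOn.continuousOn hγ).norm
  rw [← h0] at hpR
  have hbd : ∀ t, 0 ≤ t → ‖γ t‖ ≤ R + 1 := by
    by_contra! hcon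
    obtain ⟨t₁, ht₁, hgt⟩ := hcon
    let S := Icc 0 t₁ ∩ {t | R + 1 ≤ ‖γ t‖}
    have hScl : IsClosed S :=
      (hcont.mono Icc_subset_Ici_self).preimage_isClosed_of_isClosed isClosed_Icc isClosed_Ici
    have hScpt : IsCompact S := isCompact_Icc.of_isClosed_subset hScl inter_subset_left
    obtain ⟨T, ⟨hT, hTR⟩, hTmin⟩ := hScpt.exists_isLeast ⟨t₁, ⟨ht₁, le_rfl⟩, hgt.le⟩
    have hlt : ∀ t ∈ Ico 0 T, ‖γ t‖ < R + 1 := by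
      intro t ht
      by_contra! h
      exact absurd (hTmin ⟨⟨ht.1, ht.2.le.trans hT.2⟩, h⟩) (not_le.2 ht.2)
    have hsol : IsSolutionOn F γ T :=
      (hγ.isSolutionOn T).congr fun t ht => hFF' _ (hlt t ht).le
    have hle := hR γ T hsol h0
    have hTR : R + 1 ≤ ‖γ T‖ := hTR
    have hTpos : 0 < T := by
      rcases hT.1.lt_or_eq with h | h
      · exact h
      · rw [← h] at hTR; linarith
    have : ‖γ T‖ ≤ R := by
      have hc : ContinuousWithinAt (fun t => ‖γ t‖) (Ico 0 T) T :=
        (hcont T hT.1).mono Ico_subset_Ici_self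
      refine hc.closure_le (g := fun _ => R) ?_ continuousWithinAt_const hle
      rw [closure_Ico hTpos.ne]; exact ⟨hT.1, le_rfl⟩
    linarith
  refine ⟨γ, isGlobalSolution_of_forall fun T => (hγ.isSolutionOn T).congr
    fun t ht => hFF' _ (hbd t ht.1), h0, fun σ T hT hσ hσ0 => ?_⟩
  have hσ' : IsSolutionOn F' σ T := hσ.congr fun t ht => (hFF' _ (by
    linarith [hR σ T hσ hσ0 t ht])).symm
  exact hσ'.eqOn hK (hγ.isSolutionOn T) (by rw [hσ0, h0])

/-- Stands in for the invariance of ω-limit sets: a subsequence of γ(k) converges, and Lipschitz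
dependence on initial data carries the convergence to every later time. -/
lemma IsGlobalSolution.exists_limit_of_shifts {F : E → E} (hF : ContDiff ℝ 1 F) {γ : ℝ → E}
    (hγ : IsGlobalSolution F γ) {R : ℝ} (hR : ∀ t, 0 ≤ t → ‖γ t‖ ≤ R) :
    ∃ (σ : ℝ → E) (τ : ℕ → ℝ), IsGlobalSolution F σ ∧ Tendsto τ atTop atTop ∧
      ∀ s, 0 ≤ s → Tendsto (fun k => γ (τ k + s)) atTop (𝓝 (σ s)) := by
  obtain ⟨F', K, L, hK, hL, hFF'⟩ := exists_lipschitz_truncation hF R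
  obtain ⟨p, -, φ, hφ, hlim⟩ := (isCompact_closedBall (0 : E) R).tendsto_subseq
    (x := fun k : ℕ => γ k) (fun k => mem_closedBall_zero_iff.2 (hR _ k.cast_nonneg))
  obtain ⟨σ, hσ, h0⟩ := exists_isGlobalSolution_of_lipschitz hK hL p
  have hτ : Tendsto (fun k => (φ k : ℝ)) atTop atTop :=
    tendsto_natCast_atTop_atTop.comp hφ.tendsto_atTop
  have hconv : ∀ s, 0 ≤ s → Tendsto (fun k => γ (φ k + s)) atTop (𝓝 (σ s)) := by
    intro s hs
    have hsh : ∀ k, IsSolutionOn F' (fun t => γ (φ k + t)) (s + 1) := by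
      intro k t ht
      have hpos : (0 : ℝ) ≤ φ k + t := add_nonneg (φ k).cast_nonneg ht.1
      have h1 := hγ (φ k + t) hpos
      have h2 : HasDerivWithinAt (fun t : ℝ => (φ k : ℝ) + t) 1 (Ico 0 (s + 1)) t :=
        ((hasDerivAt_id t).const_add _).hasDerivWithinAt
      have := h1.scomp t h2 (fun r hr => add_nonneg (φ k).cast_nonneg hr.1)
      simpa [Function.comp_def, hFF' _ (hR _ hpos)] using this
    have hd : ∀ k, dist (γ (φ k + s)) (σ s) ≤ dist (γ (φ k)) p * Real.exp (K * s) := by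
      intro k
      simpa [h0] using (hsh k).dist_le hK (hσ.isSolutionOn _) (t := s) ⟨hs, by linarith⟩
    rw [tendsto_iff_dist_tendsto_zero]
    refine squeeze_zero (fun _ => dist_nonneg) hd ?_
    have := (tendsto_iff_dist_tendsto_zero.1 hlim).mul_const (Real.exp (K * s))
    simpa using this
  refine ⟨σ, _, isGlobalSolution_of_forall fun T => (hσ.isSolutionOn T).congr
    fun t ht => hFF' _ ?_, hτ, hconv⟩
  exact le_of_tendsto (hconv t ht.1).norm (.of_forall fun k =>
    hR _ (add_nonneg (φ k).cast_nonneg ht.1))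

end ODE

/-! ### Lyapunov forms of Hurwitz matrices and observability of skew systems. -/

section LinearAlgebra

open Module

/-- An endomorphism all of whose eigenvalues lie in the open left half-plane is strictly
dissipative for a suitable Hermitian inner product. -/
lemma exists_dissipative_embedding (d : ℕ) :
    ∀ (V : Type) [AddCommGroup V] [Module ℂ V] [FiniteDimensional ℂ V] (T : End ℂ V),
      finrank ℂ V = d → (∀ μ, T.HasEigenvalue μ → μ.re < 0) →
      ∃ (W : Type) (_ : NormedAddCommGroup W) (_ : InnerProductSpace ℂ W) (S : V →ₗ[ℂ] W)
        (c : ℝ), 0 < c ∧ Function.Injective S ∧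
        ∀ v, (inner ℂ (S v) (S (T v))).re ≤ -c * ‖S v‖ ^ 2 := by
  induction d with
  | zero =>
    intro V _ _ _ T hd _
    have : Subsingleton V := finrank_zero_iff.1 hd
    exact ⟨ℂ, inferInstance, inferInstance, 0, 1, one_pos, Function.injective_of_subsingleton _,
      by simp⟩
  | succ d ih =>
    intro V _ _ _ T hd hT
    have : Nontrivial V := nontrivial_of_finrank_pos (R := ℂ) (by omega)
    -- An eigenvector ℓ of the dual map has a T-invariant kernel, so T is block triangular on ker ℓ
    -- ⊕ ℂw and the induction applies to ker ℓ.
    obtain ⟨μ, hμ⟩ := Module.End.exists_eigenvalue (T.dualMap : End ℂ (Dual ℂ V))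
    obtain ⟨ℓ, hℓ⟩ := hμ.exists_hasEigenvector
    have hℓT : ∀ v, ℓ (T v) = μ * ℓ v := fun v => by
      simpa using LinearMap.congr_fun hℓ.apply_eq_smul v
    obtain ⟨w, hw⟩ : ∃ w, ℓ w = 1 := by
      obtain ⟨w, hw⟩ : ∃ w, ℓ w ≠ 0 := by
        by_contra! h
        exact hℓ.2 (LinearMap.ext h)
      exact ⟨(ℓ w)⁻¹ • w, by simp [hw]⟩
    -- Since ℓ ∘ (T - μ) = 0 and ℓ w = 1, the vector w is not in the range of T - μ.
    have hμT : T.HasEigenvalue μ := by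
      rw [Module.End.hasEigenvalue_iff_mem_spectrum, spectrum.mem_iff]
      intro hu
      obtain ⟨v, hv⟩ := ((Module.End.isUnit_iff _).1 hu).2 w
      have := congrArg ℓ hv
      simp [hℓT, hw, Algebra.algebraMap_eq_smul_one] at this
    have hμre := hT μ hμT
    let N := LinearMap.ker ℓ
    have hNT : ∀ v ∈ N, T v ∈ N := fun v hv => by
      rw [LinearMap.mem_ker] at hv ⊢
      simp [hℓT, hv]
    have hNd : finrank ℂ N = d := by
      have h1 := LinearMap.finrank_range_add_finrank_ker ℓ
      have h2 : finrank ℂ (LinearMap.range ℓ) = 1 := by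
        rw [LinearMap.range_eq_top.2 fun z => ⟨z • w, by simp [hw]⟩]
        simp
      change finrank ℂ (LinearMap.ker ℓ) = d
      omega
    obtain ⟨W, _, _, S, c, hc, hS, hST⟩ := ih N (T.restrict hNT) hNd fun ν hν => by
      obtain ⟨v, hv⟩ := hν.exists_hasEigenvector
      refine hT ν (Module.End.hasEigenvalue_of_hasEigenvector (x := (v : V)) ⟨?_, ?_⟩)
      · rw [Module.End.mem_eigenspace_iff]
        exact congrArg Subtype.val hv.apply_eq_smul
      · simpa using hv.2
    have hproj : ∀ v, v - ℓ v • w ∈ N := fun v => by simp [N, hw]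
    let P : V →ₗ[ℂ] N := LinearMap.codRestrict N (LinearMap.id - ℓ.smulRight w) hproj
    have hg : T w - μ • w ∈ N := by simp [N, hℓT, hw]
    let g : N := ⟨T w - μ • w, hg⟩
    have hPc : ∀ v, (P v : V) = v - ℓ v • w := fun v => rfl
    have hPT : ∀ v, P (T v) = T.restrict hNT (P v) + ℓ v • g := fun v => by
      apply Subtype.ext
      simp only [hPc, g, hℓT, Submodule.coe_add, LinearMap.coe_restrict_apply, map_sub,
        map_smul, Submodule.coe_smul]
      module
    set r := -μ.re with hr
    have hr0 : 0 < r := by linarith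
    -- The weight on the ℓ-component: large enough that the off-diagonal term, of size ‖S g‖, is
    -- absorbed by half of each diagonal dissipation.
    set κ : ℝ := 1 + ‖S g‖ ^ 2 / (c * r) with hκ
    have hκ1 : 1 ≤ κ := by rw [hκ]; linarith [show 0 ≤ ‖S g‖ ^ 2 / (c * r) by positivity]
    have hκg : ‖S g‖ ^ 2 ≤ c * r * κ ^ 2 := by
      have : ‖S g‖ ^ 2 ≤ c * r * κ := by
        rw [hκ]; field_simp; nlinarith [mul_pos hc hr0]
      nlinarith [mul_pos hc hr0]
    let S' : V →ₗ[ℂ] WithLp 2 (W × ℂ) :=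
      (WithLp.linearEquiv 2 ℂ (W × ℂ)).symm.toLinearMap ∘ₗ
        ((S ∘ₗ P).prod ((κ : ℂ) • ℓ))
    have hn : ∀ v, ‖S' v‖ ^ 2 = ‖S (P v)‖ ^ 2 + κ ^ 2 * ‖ℓ v‖ ^ 2 := fun v => by
      rw [WithLp.prod_norm_sq_eq_of_L2]
      simp [S', mul_pow]
    refine ⟨WithLp 2 (W × ℂ), inferInstance, inferInstance, S', min c r / 2, by positivity,
      ?_, fun v => ?_⟩
    · rw [← LinearMap.ker_eq_bot, LinearMap.ker_eq_bot']
      intro v hv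
      have h0 := hn v
      rw [hv, norm_zero] at h0
      have h1 : ‖S (P v)‖ ^ 2 = 0 := by
        nlinarith [sq_nonneg ‖S (P v)‖, mul_nonneg (sq_nonneg κ) (sq_nonneg ‖ℓ v‖)]
      have h2 : κ ^ 2 * ‖ℓ v‖ ^ 2 = 0 := by nlinarith
      have h2 : ℓ v = 0 := by simpa [(by linarith : κ ≠ 0)] using h2
      have h1 : P v = 0 := hS (by simpa using h1)
      have := congrArg Subtype.val h1
      simpa [hPc, h2] using this
    · have hin : (inner ℂ (S' v) (S' (T v))).re =
          (inner ℂ (S (P v)) (S (T.restrict hNT (P v)))).re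
            + (inner ℂ (S (P v)) (ℓ v • S g)).re - κ ^ 2 * r * ‖ℓ v‖ ^ 2 := by
        rw [WithLp.prod_inner_apply]
        have h3 : (inner ℂ ((κ : ℂ) * ℓ v) ((κ : ℂ) * ℓ (T v))).re
            = -(κ ^ 2 * r * ‖ℓ v‖ ^ 2) := by
          rw [hℓT]
          simp only [RCLike.inner_apply, map_mul, Complex.conj_ofReal]
          rw [show (κ : ℂ) * (μ * ℓ v) * (κ * (starRingEnd ℂ) (ℓ v))
            = ((κ ^ 2 : ℝ) : ℂ) * μ * (ℓ v * (starRingEnd ℂ) (ℓ v)) by push_cast; ring,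
            Complex.mul_conj, Complex.normSq_eq_norm_sq]
          rw [mul_right_comm, ← Complex.ofReal_mul, Complex.re_ofReal_mul, hr]
          ring
        have h4 : (inner ℂ (S (P v)) (S (P (T v)))).re =
            (inner ℂ (S (P v)) (S (T.restrict hNT (P v)))).re
              + (inner ℂ (S (P v)) (ℓ v • S g)).re := by
          rw [hPT, map_add, inner_add_right, map_smul, Complex.add_re]
        rw [← h4, sub_eq_add_neg, ← h3, ← Complex.add_re]
        simp [S']
      have h5 : (inner ℂ (S (P v)) (ℓ v • S g)).re ≤ ‖S (P v)‖ * (‖ℓ v‖ * ‖S g‖) := by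
        rw [← norm_smul]
        exact (Complex.re_le_norm _).trans (norm_inner_le_norm _ _)
      have h6 := hST (P v)
      rw [hin, hn]
      set X := ‖S (P v)‖
      set Y := ‖ℓ v‖
      set G := ‖S g‖
      have hm1 : min c r ≤ c := min_le_left _ _
      have hm2 : min c r ≤ r := min_le_right _ _
      have h7 : X * (Y * G) ≤ c / 2 * X ^ 2 + κ ^ 2 * r / 2 * Y ^ 2 := by
        have h8 : Y ^ 2 * G ^ 2 ≤ Y ^ 2 * (c * r * κ ^ 2) := by gcongr
        have h9 : 0 ≤ (c * X - Y * G) ^ 2 := sq_nonneg _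
        have h10 : 2 * c * (X * (Y * G)) ≤ 2 * c * (c / 2 * X ^ 2 + κ ^ 2 * r / 2 * Y ^ 2) := by
          linarith
        exact le_of_mul_le_mul_left h10 (by positivity)
      have h8 : min c r / 2 * X ^ 2 ≤ c / 2 * X ^ 2 := by gcongr
      have h9 : min c r / 2 * (κ ^ 2 * Y ^ 2) ≤ r / 2 * (κ ^ 2 * Y ^ 2) := by gcongr
      linarith

/-- A Lyapunov quadratic form `x ↦ ‖J x‖ ^ 2` for a real Hurwitz matrix. -/
lemma IsHurwitz.exists_lyapunov {n : ℕ} {M : Matrix (Fin n) (Fin n) ℝ} (hM : IsHurwitz M) :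
    ∃ (W : Type) (_ : NormedAddCommGroup W) (_ : InnerProductSpace ℝ W)
      (J : EuclideanSpace ℝ (Fin n) →L[ℝ] W) (c : ℝ), 0 < c ∧ (∀ x, ‖x‖ ≤ ‖J x‖) ∧
      ∀ x, inner ℝ (J x) (J (WithLp.toLp 2 (M.mulVec x.ofLp))) ≤ -c * ‖x‖ ^ 2 := by
  obtain ⟨W, _, _, S, c, hc, hS, hST⟩ := exists_dissipative_embedding (finrank ℂ (Fin n → ℂ))
    (Fin n → ℂ) (Matrix.toLin' (M.map (algebraMap ℝ ℂ))) rfl fun μ hμ => hM μ (by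
      rw [Module.End.hasEigenvalue_iff_mem_spectrum, Matrix.spectrum_toLin'] at hμ
      exact hμ)
  let ι : EuclideanSpace ℝ (Fin n) →ₗ[ℝ] (Fin n → ℂ) :=
    { toFun := fun x i => (x i : ℂ)
      map_add' := fun x y => by ext i; simp
      map_smul' := fun a x => by ext i; simp }
  have hι : ∀ x, ι (WithLp.toLp 2 (M.mulVec x.ofLp)) =
      Matrix.toLin' (M.map (algebraMap ℝ ℂ)) (ι x) := fun x => by
    ext i
    simp [ι, Matrix.mulVec, dotProduct]
  have hιinj : Function.Injective ι := fun x y h => by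
    ext i
    exact Complex.ofReal_injective (congrFun h i)
  let _ : InnerProductSpace ℝ W := InnerProductSpace.complexToReal
  let J₀ : EuclideanSpace ℝ (Fin n) →L[ℝ] W :=
    LinearMap.toContinuousLinearMap ((S.restrictScalars ℝ) ∘ₗ ι)
  have hJ₀ : ∀ x, J₀ x = S (ι x) := fun x => rfl
  obtain ⟨K, hK, hanti⟩ := J₀.toLinearMap.exists_antilipschitzWith
    (LinearMap.ker_eq_bot.2 (hS.comp hιinj))
  have hK' : (0 : ℝ) < K := hK
  have hle : ∀ x, ‖x‖ ≤ K * ‖J₀ x‖ := fun x => by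
    simpa using hanti.le_mul_dist x 0
  -- Rescaling by the antilipschitz constant makes the lower bound exactly ‖x‖ and keeps the same c.
  refine ⟨W, inferInstance, inferInstance, (K : ℝ) • J₀, c, hc, fun x => ?_, fun x => ?_⟩
  · simpa [norm_smul] using hle x
  · have h1 := hST (ι x)
    rw [← hι] at h1
    have h2 : ‖x‖ ^ 2 ≤ (K * ‖J₀ x‖) ^ 2 := by gcongr; exact hle x
    simp only [_root_.smul_apply, inner_smul_left, inner_smul_right, hJ₀]
    rw [real_inner_eq_re_inner ℂ]
    rw [hJ₀] at h2
    simp only [conj_trivial, RCLike.re_eq_complex_re]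
    calc (K : ℝ) * (K * (inner ℂ (S (ι x)) (S (ι (WithLp.toLp 2 (M.mulVec x.ofLp))))).re)
        ≤ K * (K * (-c * ‖S (ι x)‖ ^ 2)) := by gcongr
      _ = -(c * (K * ‖S (ι x)‖) ^ 2) := by ring
      _ ≤ -(c * ‖x‖ ^ 2) := by gcongr
      _ = _ := by ring

/-- Supplies the Lyapunov form of the dual system, from which observability of (b', A) is deduced.
-/
lemma IsHurwitz.transpose {n : ℕ} {M : Matrix (Fin n) (Fin n) ℝ} (hM : IsHurwitz M) :
    IsHurwitz M.transpose := by
  intro μ hμ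
  apply hM μ
  rw [spectrum.mem_iff] at hμ ⊢
  intro hu
  apply hμ
  have := (Matrix.isUnit_transpose (A := _)).2 hu
  rw [Matrix.transpose_sub] at this
  convert this using 2
  · rw [Matrix.algebraMap_eq_diagonal, Matrix.diagonal_transpose]
  · rw [Matrix.transpose_map]

variable {E W : Type*} [NormedAddCommGroup E] [InnerProductSpace ℝ E] [FiniteDimensional ℝ E]
  [NormedAddCommGroup W] [InnerProductSpace ℝ W]

/-- On an invariant subspace of a skew operator, the derivative of a quadratic form along the
flow vanishes at some nonzero vector. -/
lemma submodule_eq_bot_of_skew {A : E →L[ℝ] E} (hA : ∀ x, inner ℝ x (A x) = 0)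
    (J : E →L[ℝ] W) (N : Submodule ℝ E) (hN : ∀ v ∈ N, A v ∈ N)
    (hJ : ∀ v ∈ N, v ≠ 0 → inner ℝ (J v) (J (A v)) ≠ 0) : N = ⊥ := by
  by_contra hbot
  have : Nontrivial N := Submodule.nontrivial_iff_ne_bot.2 hbot
  obtain ⟨v, hv, hmin⟩ := (isCompact_sphere (0 : N) 1).exists_isMinOn
    (NormedSpace.sphere_nonempty.2 zero_le_one) (f := fun v : N => ‖J v‖ ^ 2)
    (by fun_prop)
  have hv1 : ‖(v : E)‖ = 1 := by simpa using hv
  have hbound : ∀ w : N, ‖J v‖ ^ 2 * ‖(w : E)‖ ^ 2 ≤ ‖J w‖ ^ 2 := by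
    intro w
    rcases eq_or_ne w 0 with rfl | hw
    · simp
    have hw' : 0 < ‖(w : E)‖ := by simpa using hw
    have hmem : (‖(w : E)‖⁻¹ • w) ∈ Metric.sphere (0 : N) 1 := by
      rw [mem_sphere_zero_iff_norm, norm_smul, norm_inv, norm_norm, Submodule.coe_norm]
      exact inv_mul_cancel₀ hw'.ne'
    have := hmin hmem
    simp only [mem_ofPred_eq, Submodule.coe_smul, map_smul, norm_smul, norm_inv, norm_norm,
      mul_pow, inv_pow] at this
    rw [le_inv_mul_iff₀ (by positivity)] at this
    linarith
  refine hJ v v.2 (by rw [← norm_ne_zero_iff, hv1]; exact one_ne_zero) ?_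
  set a := inner ℝ (J (v : E)) (J (A v)) with ha
  -- Perturb the minimizer v of ‖J ·‖ on the unit sphere of N in the direction A v, which is tangent
  -- because A is skew. The quadratic in t is nonnegative and vanishes at 0, so its linear
  -- coefficient is zero.
  have hquad : ∀ t : ℝ, 0 ≤ (‖J (A v)‖ ^ 2 - ‖J v‖ ^ 2 * ‖A v‖ ^ 2) * (t * t) + 2 * a * t + 0 := by
    intro t
    have := hbound (v + t • ⟨A v, hN v v.2⟩)
    simp only [Submodule.coe_add, Submodule.coe_smul, map_add, map_smul] at this
    rw [norm_add_sq_real, norm_add_sq_real, inner_smul_right, inner_smul_right, hA, hv1, norm_smul,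
      norm_smul, mul_pow, mul_pow, ← ha, Real.norm_eq_abs, sq_abs] at this
    linarith
  have := discrim_le_zero hquad
  rw [discrim] at this
  nlinarith [sq_nonneg a]

/-- Observability of `(⟪k, ·⟫, A)`, formulated along trajectories of `v' = A v`. -/
lemma eq_zero_of_eventually_inner_eq_zero {A : E →L[ℝ] E} (hA : ∀ x, inner ℝ x (A x) = 0)
    (J : E →L[ℝ] W) {k : E} (hJ : ∀ v, v ≠ 0 → inner ℝ k v = 0 → inner ℝ (J v) (J (A v)) ≠ 0)
    {v : ℝ → E} {s : ℝ} (hv : ∀ᶠ t in 𝓝 s, HasDerivAt v (A (v t)) t)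
    (hk : ∀ᶠ t in 𝓝 s, inner ℝ k (v t) = 0) : v s = 0 := by
  have hall : ∀ i : ℕ, ∀ᶠ t in 𝓝 s, inner ℝ k ((A ^ i) (v t)) = 0 := by
    intro i
    induction i with
    | zero => simpa using hk
    | succ i ih =>
      filter_upwards [hv, ih.eventually_nhds] with t hvt hit
      have h1 : HasDerivAt (fun t => inner ℝ k ((A ^ i) (v t))) (inner ℝ k ((A ^ i) (A (v t)))) t :=
        ((innerSL ℝ k).comp (A ^ i)).hasFDerivAt.comp_hasDerivAt t hvt
      have h2 : HasDerivAt (fun t => inner ℝ k ((A ^ i) (v t))) 0 t :=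
        (hasDerivAt_const t (0 : ℝ)).congr_of_eventuallyEq hit
      rw [pow_succ]
      exact h1.unique h2
  -- The unobservable subspace: A-invariant and inside the orthogonal complement of k.
  let N : Submodule ℝ E := ⨅ i : ℕ, LinearMap.ker ((innerSL ℝ k).comp (A ^ i)).toLinearMap
  have hmem : ∀ w, w ∈ N ↔ ∀ i : ℕ, inner ℝ k ((A ^ i) w) = 0 := fun w => by
    simp only [N, Submodule.mem_iInf]; rfl
  have hN : N = ⊥ := by
    refine submodule_eq_bot_of_skew hA J N (fun w hw => ?_) fun w hw hw0 => hJ w hw0 ?_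
    · rw [hmem] at hw ⊢
      exact fun i => by simpa [pow_succ] using hw (i + 1)
    · simpa using (hmem w).1 hw 0
  have : v s ∈ N := (hmem _).2 fun i => (hall i).self_of_nhds
  simpa [hN] using this

end LinearAlgebra

/-! ### Scalar comparison arguments. -/

section Barrier

lemma le_of_deriv_neg_at_level {E : Type*} [NormedAddCommGroup E] [NormedSpace ℝ E] {F : E → E}
    {γ : ℝ → E} {T : ℝ} (hγ : IsSolutionOn F γ T) {f : E → ℝ} {f' : E → ℝ} (hf : Continuous f)
    (hf' : ∀ t ∈ Ico 0 T, HasDerivWithinAt (fun t => f (γ t)) (f' (γ t)) (Ici t) t) {B : ℝ}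
    (h0 : f (γ 0) ≤ B) (hB : ∀ t ∈ Ico 0 T, f (γ t) = B → f' (γ t) < 0) :
    ∀ t ∈ Ico 0 T, f (γ t) ≤ B := by
  intro t ht
  have hsub : Icc 0 t ⊆ Ico 0 T := fun s hs => ⟨hs.1, hs.2.trans_lt ht.2⟩
  exact image_le_of_deriv_right_lt_deriv_boundary (B := fun _ => B) (B' := fun _ => 0)
    (hf.comp_continuousOn ((IsIntegralCurveOn.continuousOn hγ).mono hsub))
    (fun s hs => hf' s (hsub (Ico_subset_Icc_self hs))) h0
    (fun _ => hasDerivAt_const _ _) (fun s hs => hB s (hsub (Ico_subset_Icc_self hs)))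
    (right_mem_Icc.2 ht.1)

lemma le_initial_of_deriv_nonpos {E : Type*} [NormedAddCommGroup E] [NormedSpace ℝ E] {F : E → E}
    {γ : ℝ → E} {T : ℝ} (hγ : IsSolutionOn F γ T) {f : E → ℝ} {f' : E → ℝ} (hf : Continuous f)
    (hf' : ∀ t ∈ Ico 0 T, HasDerivWithinAt (fun t => f (γ t)) (f' (γ t)) (Ici t) t)
    (hB : ∀ t ∈ Ico 0 T, f' (γ t) ≤ 0) {s t : ℝ} (hs : 0 ≤ s) (hst : s ≤ t) (htT : t < T) :
    f (γ t) ≤ f (γ s) := by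
  have hsub : Icc s t ⊆ Ico 0 T := fun r hr => ⟨hs.trans hr.1, hr.2.trans_lt htT⟩
  exact image_le_of_deriv_right_le_deriv_boundary (B := fun _ => f (γ s)) (B' := fun _ => 0)
    (hf.comp_continuousOn ((IsIntegralCurveOn.continuousOn hγ).mono hsub))
    (fun r hr => hf' r (hsub (Ico_subset_Icc_self hr))) le_rfl
    continuousOn_const (fun _ _ => (hasDerivAt_const _ _).hasDerivWithinAt)
    (fun r hr => hB r (hsub (Ico_subset_Icc_self hr)))
    (right_mem_Icc.2 hst)

/-- A nonnegative function with `f' ≤ -κ f + g` and `g → 0` tends to zero. -/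
lemma tendsto_zero_of_deriv_le {f f' g : ℝ → ℝ} {κ : ℝ} (hκ : 0 < κ) (hf0 : ∀ t, 0 ≤ f t)
    (hf : ∀ t, 0 < t → HasDerivAt f (f' t) t) (hfg : ∀ t, 0 < t → f' t ≤ -κ * f t + g t)
    (hg : Tendsto g atTop (𝓝 0)) : Tendsto f atTop (𝓝 0) := by
  rw [Metric.tendsto_atTop]
  intro ε hε
  obtain ⟨N, hN⟩ := eventually_atTop.1 (hg.eventually_lt_const (show 0 < κ * (ε / 2) by positivity))
  -- Beyond a the forcing is below κε/2, so the comparison solution relaxes to ε/2; a must be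
  -- positive because derivatives are given only there.
  set a := max N 1
  have ha : 0 < a := lt_of_lt_of_le one_pos (le_max_right _ _)
  have key : ∀ t, a ≤ t →
      f t ≤ f a * Real.exp (-κ * (t - a)) + ε / 2 * (1 - Real.exp (-κ * (t - a))) := by
    intro t hat
    have h1 : f t ≤ gronwallBound (f a) (-κ) (κ * (ε / 2)) (t - a) := by
      refine le_gronwallBound_of_liminf_deriv_right_le (f' := f')
        (fun s hs => (hf s (ha.trans_le hs.1)).continuousAt.continuousWithinAt)
        (fun s hs r hr => (hf s (ha.trans_le hs.1)).hasDerivWithinAt.liminf_right_slope_le hr)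
        le_rfl (fun s hs => ?_) t (right_mem_Icc.2 hat)
      linarith [hfg s (ha.trans_le hs.1), hN s ((le_max_left _ _).trans hs.1)]
    rw [gronwallBound_of_K_ne_0 (neg_ne_zero.2 hκ.ne')] at h1
    refine h1.trans_eq ?_
    field_simp
    ring
  have hexp : Tendsto (fun t => Real.exp (-κ * (t - a))) atTop (𝓝 0) :=
    Real.tendsto_exp_atBot.comp (((tendsto_id.atTop_add tendsto_const_nhds).const_mul_atTop_of_neg
      (neg_lt_zero.2 hκ)))
  have hlim := (hexp.const_mul (f a)).add ((hexp.const_sub 1).const_mul (ε / 2))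
  obtain ⟨N', hN'⟩ := eventually_atTop.1 (hlim.eventually_lt_const (show _ < ε by simpa using hε))
  refine ⟨max a N', fun t ht => ?_⟩
  rw [Real.dist_eq, sub_zero, abs_of_nonneg (hf0 t)]
  exact (key t ((le_max_left _ _).trans ht)).trans_lt (hN' t ((le_max_right _ _).trans ht))

end Barrier

/-! ### The observer loop in error coordinates. -/

section Loop

variable {E W X : Type*} [NormedAddCommGroup E] [InnerProductSpace ℝ E]
  [NormedAddCommGroup W] [InnerProductSpace ℝ W] [NormedAddCommGroup X] [InnerProductSpace ℝ X]

/-- The control `u = ⟪k, x̂⟫ + δ ŷ`, where `x̂ = π w` and `ŷ = η w`. -/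
noncomputable def control (k : E) (δ : ℝ) (π : W →L[ℝ] E) (η : W →L[ℝ] ℝ) (p : E × W) : ℝ :=
  inner ℝ k (π p.2) + δ * η p.2

/-- The state estimation error `x̂ - x`. -/
def stateError (π : W →L[ℝ] E) (p : E × W) : E := π p.2 - p.1

/-- The output estimation error `ŷ - |x|² / 2`. -/
noncomputable def outputError (η : W →L[ℝ] ℝ) (p : E × W) : ℝ := η p.2 - ‖p.1‖ ^ 2 / 2

/-- The squared norm of the estimation error. -/
noncomputable def errorEnergy (π : W →L[ℝ] E) (η : W →L[ℝ] ℝ) (p : E × W) : ℝ :=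
  ‖stateError π p‖ ^ 2 + outputError η p ^ 2

/-- `F` is the closed loop of the plant with its observer, in coordinates `x̂ = π w`, `ŷ = η w`. -/
structure IsObserverLoop (A : E →L[ℝ] E) (b k : E) (δ α : ℝ) (π : W →L[ℝ] E) (η : W →L[ℝ] ℝ)
    (F : E × W → E × W) : Prop where
  contDiff : ContDiff ℝ 1 F
  norm_sq : ∀ w, ‖w‖ ^ 2 = ‖π w‖ ^ 2 + η w ^ 2
  plant : ∀ p, (F p).1 = A p.1 + control k δ π η p • b
  state : ∀ p, π (F p).2 = A (π p.2) +
    (control k δ π η p - control k δ π η p * outputError η p) • b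
  output : ∀ p, η (F p).2 = control k δ π η p * inner ℝ b (π p.2) - α * outputError η p

variable {A : E →L[ℝ] E} {b k : E} {δ α : ℝ} {π : W →L[ℝ] E} {η : W →L[ℝ] ℝ}
  {F : E × W → E × W} {J : E →L[ℝ] X} {c : ℝ}

lemma continuous_errorEnergy : Continuous (errorEnergy π η) := by
  unfold errorEnergy stateError outputError
  fun_prop

lemma errorEnergy_nonneg (p : E × W) : 0 ≤ errorEnergy π η p := by
  unfold errorEnergy; positivity

namespace IsObserverLoop

lemma map_zero (h : IsObserverLoop A b k δ α π η F) : F 0 = 0 := by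
  have h1 : (F 0).1 = 0 := by simp [h.plant, control]
  have h2 : π (F 0).2 = 0 := by simp [h.state, control]
  have h3 : η (F 0).2 = 0 := by simp [h.output, control, outputError]
  have h4 := h.norm_sq (F 0).2
  rw [h2, h3] at h4
  exact Prod.ext h1 (by simpa using h4)

lemma hasDerivWithinAt_fst {γ : ℝ → E × W} {s : Set ℝ} {t : ℝ}
    (hγ : HasDerivWithinAt γ (F (γ t)) s t) :
    HasDerivWithinAt (fun t => (γ t).1) (F (γ t)).1 s t :=
  (ContinuousLinearMap.fst ℝ E W).hasFDerivAt.comp_hasDerivWithinAt t hγ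

lemma hasDerivWithinAt_clm_snd {Y : Type*} [NormedAddCommGroup Y] [NormedSpace ℝ Y]
    (ψ : W →L[ℝ] Y) {γ : ℝ → E × W} {s : Set ℝ} {t : ℝ}
    (hγ : HasDerivWithinAt γ (F (γ t)) s t) :
    HasDerivWithinAt (fun t => ψ (γ t).2) (ψ (F (γ t)).2) s t :=
  (ψ.comp (ContinuousLinearMap.snd ℝ E W)).hasFDerivAt.comp_hasDerivWithinAt t hγ

lemma hasDerivWithinAt_stateError (h : IsObserverLoop A b k δ α π η F) {γ : ℝ → E × W}
    {s : Set ℝ} {t : ℝ} (hγ : HasDerivWithinAt γ (F (γ t)) s t) :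
    HasDerivWithinAt (fun t => stateError π (γ t)) (A (stateError π (γ t)) -
      (control k δ π η (γ t) * outputError η (γ t)) • b) s t := by
  refine ((hasDerivWithinAt_clm_snd π hγ).sub (hasDerivWithinAt_fst hγ)).congr_deriv ?_
  rw [h.state, h.plant, stateError, map_sub]
  module

lemma hasDerivWithinAt_outputError (hA : ∀ x, inner ℝ x (A x) = 0)
    (h : IsObserverLoop A b k δ α π η F) {γ : ℝ → E × W}
    {s : Set ℝ} {t : ℝ} (hγ : HasDerivWithinAt γ (F (γ t)) s t) :
    HasDerivWithinAt (fun t => outputError η (γ t))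
      (control k δ π η (γ t) * inner ℝ b (stateError π (γ t)) - α * outputError η (γ t)) s t := by
  refine ((hasDerivWithinAt_clm_snd η hγ).sub
    ((hasDerivWithinAt_fst hγ).norm_sq.div_const 2)).congr_deriv ?_
  rw [h.output, h.plant, stateError, inner_add_right, hA, inner_smul_right, inner_sub_right,
    real_inner_comm b]
  ring

/-- The two cross terms in u ε_y b'ε cancel and A contributes nothing, being skew; only the gain α
dissipates. -/
lemma hasDerivWithinAt_errorEnergy (hA : ∀ x, inner ℝ x (A x) = 0)
    (h : IsObserverLoop A b k δ α π η F) {γ : ℝ → E × W}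
    {s : Set ℝ} {t : ℝ} (hγ : HasDerivWithinAt γ (F (γ t)) s t) :
    HasDerivWithinAt (fun t => errorEnergy π η (γ t)) (-(2 * α * outputError η (γ t) ^ 2)) s t := by
  refine ((h.hasDerivWithinAt_stateError hγ).norm_sq.add
    ((h.hasDerivWithinAt_outputError hA hγ).fun_pow 2)).congr_deriv ?_
  rw [inner_sub_right, hA, inner_smul_right, real_inner_comm b]
  push_cast
  ring

lemma hasDerivWithinAt_lyapunov (J : E →L[ℝ] X) {γ : ℝ → E × W}
    {s : Set ℝ} {t : ℝ} (hγ : HasDerivWithinAt γ (F (γ t)) s t) :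
    HasDerivWithinAt (fun t => ‖J (π (γ t).2)‖ ^ 2)
      (2 * inner ℝ (J (π (γ t).2)) (J (π (F (γ t)).2))) s t :=
  (hasDerivWithinAt_clm_snd (J.comp π) hγ).norm_sq

lemma errorEnergy_le (hA : ∀ x, inner ℝ x (A x) = 0)
    (h : IsObserverLoop A b k δ α π η F) (hα : 0 ≤ α) {γ : ℝ → E × W} {T : ℝ}
    (hγ : IsSolutionOn F γ T) {s t : ℝ} (hs : 0 ≤ s) (hst : s ≤ t) (htT : t < T) :
    errorEnergy π η (γ t) ≤ errorEnergy π η (γ s) :=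
  le_initial_of_deriv_nonpos hγ continuous_errorEnergy
    (f' := fun p => -(2 * α * outputError η p ^ 2))
    (fun _ hr => h.hasDerivWithinAt_errorEnergy hA (hγ.hasDerivWithinAt_Ici hr))
    (fun _ _ => neg_nonpos.2 (by positivity)) hs hst htT

/-- The state is recovered from x̂ and the errors by x = x̂ - ε and ŷ = ε_y + |x|²/2. The bound
vanishes with m, so it serves boundedness, convergence and stability alike. -/
lemma norm_le (h : IsObserverLoop A b k δ α π η F) (hJ : ∀ x, ‖x‖ ≤ ‖J x‖) {p : E × W} {m : ℝ}
    (h1 : ‖J (π p.2)‖ ^ 2 ≤ m) (h2 : errorEnergy π η p ≤ m) : ‖p‖ ≤ 2 * √m + 2 * m := by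
  have hm : 0 ≤ m := (sq_nonneg _).trans h1
  have hz : ‖π p.2‖ ≤ √m := (hJ _).trans (Real.le_sqrt_of_sq_le h1)
  have hx : ‖stateError π p‖ ≤ √m := Real.le_sqrt_of_sq_le (by
    unfold errorEnergy at h2; nlinarith [sq_nonneg (outputError η p)])
  have hy : |outputError η p| ≤ √m := Real.abs_le_sqrt (by
    unfold errorEnergy at h2; nlinarith [sq_nonneg ‖stateError π p‖])
  have hp : ‖p.1‖ ≤ 2 * √m := by
    have : p.1 = π p.2 - stateError π p := by simp [stateError]
    rw [this]
    linarith [norm_sub_le (π p.2) (stateError π p)]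
  have hη : |η p.2| ≤ √m + 2 * m := by
    have : η p.2 = outputError η p + ‖p.1‖ ^ 2 / 2 := by simp [outputError]
    rw [this]
    have hsq : ‖p.1‖ ^ 2 ≤ (2 * √m) ^ 2 := by gcongr
    rw [mul_pow, Real.sq_sqrt hm] at hsq
    have h3 := abs_add_le (outputError η p) (‖p.1‖ ^ 2 / 2)
    rw [abs_of_nonneg (show 0 ≤ ‖p.1‖ ^ 2 / 2 by positivity)] at h3
    linarith
  have hw : ‖p.2‖ ≤ ‖π p.2‖ + |η p.2| := by
    refine abs_le_of_sq_le_sq' ?_ (by positivity) |>.2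
    rw [h.norm_sq]
    nlinarith [norm_nonneg (π p.2), abs_nonneg (η p.2), sq_abs (η p.2)]
  rw [Prod.norm_def]
  exact max_le (by linarith) (by linarith)

lemma abs_output_le (p : E × W) :
    |η p.2| ≤ ‖π p.2‖ ^ 2 + ‖stateError π p‖ ^ 2 + |outputError η p| := by
  have h1 : η p.2 = outputError η p + ‖p.1‖ ^ 2 / 2 := by simp [outputError]
  have h2 : p.1 = π p.2 - stateError π p := by simp [stateError]
  have h3 : ‖p.1‖ ≤ ‖π p.2‖ + ‖stateError π p‖ := by
    conv_lhs => rw [h2]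
    exact norm_sub_le _ _
  have h4 : ‖p.1‖ ^ 2 ≤ (‖π p.2‖ + ‖stateError π p‖) ^ 2 := by gcongr
  have h5 := abs_add_le (outputError η p) (‖p.1‖ ^ 2 / 2)
  rw [abs_of_nonneg (show 0 ≤ ‖p.1‖ ^ 2 / 2 by positivity)] at h5
  rw [h1]
  nlinarith [sq_nonneg (‖π p.2‖ - ‖stateError π p‖)]

/-- The x̂-dynamics is the nominal closed loop A + bK plus the scalar disturbance δŷ - u ε_y along
b. -/
lemma lyapunov_deriv_le (h : IsObserverLoop A b k δ α π η F)
    (hJc : ∀ x, inner ℝ (J x) (J (A x + inner ℝ k x • b)) ≤ -c * ‖x‖ ^ 2) (p : E × W) :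
    2 * inner ℝ (J (π p.2)) (J (π (F p).2)) ≤ -(2 * c * ‖π p.2‖ ^ 2) +
      2 * (‖J‖ * ‖J b‖ * ‖π p.2‖) * |δ * η p.2 - control k δ π η p * outputError η p| := by
  have h1 : π (F p).2 = (A (π p.2) + inner ℝ k (π p.2) • b) +
      (δ * η p.2 - control k δ π η p * outputError η p) • b := by
    rw [h.state, control]; module
  rw [h1, map_add, inner_add_right, map_smul, inner_smul_right]
  set s := δ * η p.2 - control k δ π η p * outputError η p
  have h2 : s * inner ℝ (J (π p.2)) (J b) ≤ |s| * (‖J‖ * ‖π p.2‖ * ‖J b‖) := by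
    refine (le_abs_self _).trans ?_
    rw [abs_mul]
    gcongr
    exact (abs_real_inner_le_norm _ _).trans (by gcongr; exact J.le_opNorm _)
  linarith [hJc (π p.2)]

end IsObserverLoop

end Loop

/-! ### Uniform bounds and the choice of gains. -/

section Estimates

variable {E W X : Type*} [NormedAddCommGroup E] [InnerProductSpace ℝ E]
  [NormedAddCommGroup W] [InnerProductSpace ℝ W] [NormedAddCommGroup X] [InnerProductSpace ℝ X]
  {A : E →L[ℝ] E} {b k : E} {δ α : ℝ} {π : W →L[ℝ] E} {η : W →L[ℝ] ℝ}
  {F : E × W → E × W} {J : E →L[ℝ] X} {c : ℝ}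

namespace IsObserverLoop

lemma abs_output_le_of_bounded {p : E × W} {B₁ B₂ : ℝ} (hB₂ : 1 ≤ B₂)
    (hz : ‖π p.2‖ ^ 2 ≤ B₁) (he : errorEnergy π η p ≤ B₂) : |η p.2| ≤ B₁ + 2 * B₂ := by
  have h1 := abs_output_le (π := π) (η := η) p
  unfold errorEnergy at he
  have h2 : ‖stateError π p‖ ^ 2 ≤ B₂ := by nlinarith [sq_nonneg (outputError η p)]
  have h3 : |outputError η p| ≤ B₂ :=
    abs_le_of_sq_le_sq (by nlinarith [sq_nonneg ‖stateError π p‖]) (by linarith)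
  linarith

lemma abs_control_le_of_bounded (hδ : 0 ≤ δ) (hδ1 : δ ≤ 1) {p : E × W} {B₁ B₂ : ℝ} (hB₂ : 1 ≤ B₂)
    (hz : ‖π p.2‖ ^ 2 ≤ B₁) (he : errorEnergy π η p ≤ B₂) :
    |control k δ π η p| ≤ ‖k‖ * (B₁ + 1) + (B₁ + 2 * B₂) := by
  have h1 := abs_output_le_of_bounded hB₂ hz he
  have h2 : ‖π p.2‖ ≤ B₁ + 1 := by nlinarith [sq_nonneg (‖π p.2‖ - 1)]
  have h3 : |inner ℝ k (π p.2)| ≤ ‖k‖ * (B₁ + 1) :=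
    (abs_real_inner_le_norm _ _).trans (by gcongr)
  have h4 : |δ * η p.2| ≤ 1 * (B₁ + 2 * B₂) := by
    rw [abs_mul, abs_of_nonneg hδ]; gcongr
  unfold control
  linarith [abs_add_le (inner ℝ k (π p.2)) (δ * η p.2)]

/-- Young's inequality applied to the disturbance. The ε_y² term is kept explicit so that the decay
of the error energy can cancel it. -/
lemma lyapunov_deriv_le_of_bounded (h : IsObserverLoop A b k δ α π η F) (hc : 0 < c)
    (hJc : ∀ x, inner ℝ (J x) (J (A x + inner ℝ k x • b)) ≤ -c * ‖x‖ ^ 2)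
    (hδ : 0 ≤ δ) (hδ1 : δ ≤ 1) {p : E × W} {B₁ B₂ : ℝ} (hB₂ : 1 ≤ B₂)
    (hz : ‖π p.2‖ ^ 2 ≤ B₁) (he : errorEnergy π η p ≤ B₂) :
    2 * inner ℝ (J (π p.2)) (J (π (F p).2)) ≤ -(c * ‖π p.2‖ ^ 2) +
      2 * (‖J‖ * ‖J b‖) ^ 2 / c * (δ ^ 2 * (B₁ + 2 * B₂) ^ 2 +
        (‖k‖ * (B₁ + 1) + (B₁ + 2 * B₂)) ^ 2 * outputError η p ^ 2) := by
  have h1 := h.lyapunov_deriv_le hJc p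
  have h2 := sq_le_sq' (abs_le.1 (abs_output_le_of_bounded hB₂ hz he)).1
    (abs_le.1 (abs_output_le_of_bounded hB₂ hz he)).2
  have hu := abs_control_le_of_bounded (k := k) hδ hδ1 hB₂ hz he
  have h3 := sq_le_sq' (abs_le.1 hu).1 (abs_le.1 hu).2
  set H := ‖J‖ * ‖J b‖
  set Z := ‖π p.2‖
  set Y := B₁ + 2 * B₂
  set U := ‖k‖ * (B₁ + 1) + Y
  set u := control k δ π η p
  set o := outputError η p
  set s := δ * η p.2 - u * o with hs
  have h4 : s ^ 2 ≤ 2 * (δ ^ 2 * Y ^ 2 + U ^ 2 * o ^ 2) := by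
    have h5 : δ ^ 2 * η p.2 ^ 2 ≤ δ ^ 2 * Y ^ 2 := by gcongr
    have h6 : u ^ 2 * o ^ 2 ≤ U ^ 2 * o ^ 2 := by gcongr
    nlinarith [sq_nonneg (δ * η p.2 + u * o)]
  have h5 : 2 * (H * Z) * |s| ≤ c * Z ^ 2 + H ^ 2 / c * s ^ 2 := by
    have : c * (2 * (H * Z) * |s|) ≤ c * (c * Z ^ 2 + H ^ 2 / c * s ^ 2) := by
      have h7 : c * (c * Z ^ 2 + H ^ 2 / c * s ^ 2) = (c * Z) ^ 2 + (H * |s|) ^ 2 := by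
        rw [mul_pow H, sq_abs]; field_simp
      rw [h7]
      nlinarith [sq_nonneg (c * Z - H * |s|)]
    exact le_of_mul_le_mul_left this hc
  have h6 : H ^ 2 / c * s ^ 2 ≤ H ^ 2 / c * (2 * (δ ^ 2 * Y ^ 2 + U ^ 2 * o ^ 2)) := by gcongr
  have h7 : H ^ 2 / c * (2 * (δ ^ 2 * Y ^ 2 + U ^ 2 * o ^ 2)) =
    2 * H ^ 2 / c * (δ ^ 2 * Y ^ 2 + U ^ 2 * o ^ 2) := by ring
  linarith

/-- Here the remainder must vanish with the error energy. As |ŷ| ≤ |x̂|² + |ε|² + |ε_y|, the |x̂|²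
part of δŷ is absorbed by small δ and the rest is of the order of the error. -/
lemma lyapunov_deriv_le_errorEnergy (h : IsObserverLoop A b k δ α π η F) (hc : 0 < c)
    (hJc : ∀ x, inner ℝ (J x) (J (A x + inner ℝ k x • b)) ≤ -c * ‖x‖ ^ 2)
    (hδ : 0 ≤ δ) (hδ1 : δ ≤ 1) {p : E × W} {B₁ B₂ : ℝ} (hB₂ : 1 ≤ B₂)
    (hδB : 2 * (‖J‖ * ‖J b‖) * (B₁ + 1) * δ ≤ c)
    (hz : ‖π p.2‖ ^ 2 ≤ B₁) (he : errorEnergy π η p ≤ B₂) :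
    2 * inner ℝ (J (π p.2)) (J (π (F p).2)) ≤ -(c / 2 * ‖π p.2‖ ^ 2) +
      2 * (‖J‖ * ‖J b‖ * (B₂ + 1 + (‖k‖ * (B₁ + 1) + (B₁ + 2 * B₂)))) ^ 2 / c *
        errorEnergy π η p := by
  have h1 := h.lyapunov_deriv_le hJc p
  have hη := abs_output_le (π := π) (η := η) p
  have hu := abs_control_le_of_bounded (k := k) hδ hδ1 hB₂ hz he
  have he0 := errorEnergy_nonneg (π := π) (η := η) p
  have hB₁ : 0 ≤ B₁ := (sq_nonneg _).trans hz
  set e := errorEnergy π η p with hedef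
  have hr2 : √e ^ 2 = e := Real.sq_sqrt he0
  have hx : ‖stateError π p‖ ≤ √e := Real.le_sqrt_of_sq_le (by
    rw [hedef, errorEnergy]; nlinarith [sq_nonneg (outputError η p)])
  have hy : |outputError η p| ≤ √e := Real.abs_le_sqrt (by
    rw [hedef, errorEnergy]; nlinarith [sq_nonneg ‖stateError π p‖])
  have hrB : √e ≤ B₂ := by
    rw [Real.sqrt_le_left (by linarith)]; nlinarith
  set H := ‖J‖ * ‖J b‖ with hH
  have hH0 : 0 ≤ H := by positivity
  set Z := ‖π p.2‖
  have hZ0 : 0 ≤ Z := norm_nonneg _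
  set U := ‖k‖ * (B₁ + 1) + (B₁ + 2 * B₂)
  have hU0 : 0 ≤ U := (abs_nonneg _).trans hu
  set u := control k δ π η p
  set o := outputError η p
  set r := √e
  have hr0 : 0 ≤ r := Real.sqrt_nonneg _
  set G := B₂ + 1 + U
  have hZ : Z ≤ B₁ + 1 := by nlinarith [sq_nonneg (Z - 1)]
  have hs : |δ * η p.2 - u * o| ≤ δ * (B₁ + 1) * Z + G * r := by
    have h2 : |δ * η p.2| ≤ δ * ((B₁ + 1) * Z) + (B₂ * r + r) := by
      rw [abs_mul, abs_of_nonneg hδ]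
      have h3 : ‖stateError π p‖ ^ 2 ≤ B₂ * r := by
        rw [sq]; gcongr; exact hx.trans hrB
      have h4 : Z ^ 2 ≤ (B₁ + 1) * Z := by rw [sq]; gcongr
      calc δ * |η p.2| ≤ δ * ((B₁ + 1) * Z + (B₂ * r + r)) := by gcongr; linarith
        _ ≤ δ * ((B₁ + 1) * Z) + 1 * (B₂ * r + r) := by rw [mul_add]; gcongr
        _ = _ := by ring
    have h3 : |u * o| ≤ U * r := by rw [abs_mul]; gcongr
    have h4 := abs_sub (δ * η p.2) (u * o)
    linarith
  have h2 : 2 * (H * Z) * |δ * η p.2 - u * o| ≤ 2 * (H * Z) * (δ * (B₁ + 1) * Z + G * r) := by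
    gcongr
  have h3 : 2 * (H * Z) * (δ * (B₁ + 1) * Z) ≤ c * Z ^ 2 := by
    calc _ = (2 * H * (B₁ + 1) * δ) * Z ^ 2 := by ring
      _ ≤ c * Z ^ 2 := by gcongr
  have h4 : 2 * (H * Z) * (G * r) ≤ c / 2 * Z ^ 2 + 2 * (H * G) ^ 2 / c * e := by
    have : c * (2 * (H * Z) * (G * r)) ≤ c * (c / 2 * Z ^ 2 + 2 * (H * G) ^ 2 / c * e) := by
      have h7 : c * (c / 2 * Z ^ 2 + 2 * (H * G) ^ 2 / c * e) =
          ((c * Z) ^ 2 + (2 * (H * G) * r) ^ 2) / 2 := by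
        rw [← hr2]; field_simp
      rw [h7]
      nlinarith [sq_nonneg (c * Z - 2 * (H * G) * r)]
    exact le_of_mul_le_mul_left this hc
  linarith

end IsObserverLoop

/-- On every ball of initial conditions, for a small perturbation `δ` and a high gain `α`, the
Lyapunov function of the feedback stays bounded and satisfies a dissipation inequality. -/
lemma exists_uniform_dissipation [FiniteDimensional ℝ E] [FiniteDimensional ℝ W]
    (hA : ∀ x, inner ℝ x (A x) = 0) (b k : E) (π : W →L[ℝ] E) (η : W →L[ℝ] ℝ) (hc : 0 < c)
    (hJ : ∀ x, ‖x‖ ≤ ‖J x‖)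
    (hJc : ∀ x, inner ℝ (J x) (J (A x + inner ℝ k x • b)) ≤ -c * ‖x‖ ^ 2) (R : ℝ) :
    ∃ δ₀ > 0, ∃ α₀ > 0, ∃ B κ C : ℝ, 0 < κ ∧ 0 < C ∧
      ∀ δ ∈ Ioo 0 δ₀, ∀ α ∈ Ioi α₀, ∀ F : E × W → E × W, IsObserverLoop A b k δ α π η F →
      ∀ (γ : ℝ → E × W) (T : ℝ), IsSolutionOn F γ T → ‖γ 0‖ ≤ R → ∀ t ∈ Ico 0 T,
        ‖J (π (γ t).2)‖ ^ 2 ≤ B ∧ errorEnergy π η (γ t) ≤ B ∧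
        2 * inner ℝ (J (π (γ t).2)) (J (π (F (γ t)).2)) ≤
          -κ * ‖J (π (γ t).2)‖ ^ 2 + C * errorEnergy π η (γ t) := by
  have hVc : Continuous fun p : E × W => ‖J (π p.2)‖ ^ 2 := by fun_prop
  obtain ⟨B₂, hB₂⟩ := (isCompact_closedBall (0 : E × W) R).exists_bound_of_continuousOn
    (continuous_errorEnergy (π := π) (η := η)).continuousOn
  obtain ⟨B₀, hB₀⟩ := (isCompact_closedBall (0 : E × W) R).exists_bound_of_continuousOn
    hVc.continuousOn
  have hB₂' : ∀ p : E × W, ‖p‖ ≤ R → errorEnergy π η p ≤ max B₂ 1 := fun p hp =>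
    (le_abs_self _).trans ((hB₂ p (mem_closedBall_zero_iff.2 hp)).trans (le_max_left _ _))
  have hB₀' : ∀ p : E × W, ‖p‖ ≤ R → ‖J (π p.2)‖ ^ 2 ≤ max B₀ 1 := fun p hp =>
    (le_abs_self _).trans ((hB₀ p (mem_closedBall_zero_iff.2 hp)).trans (le_max_left _ _))
  have hb₂ : 1 ≤ max B₂ 1 := le_max_right _ _
  have hb₀ : 1 ≤ max B₀ 1 := le_max_right _ _
  set b₂ := max B₂ 1
  set L := max B₀ 1 + 1 with hL
  set H := ‖J‖ * ‖J b‖ with hH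
  have hH0 : 0 ≤ H := by positivity
  set Y := L + 2 * b₂ with hY
  set U := ‖k‖ * (L + 1) + Y with hU
  set D := H ^ 2 / c * U ^ 2 with hD
  set P := ‖J‖ ^ 2 + 1 with hP
  have hP0 : 0 < P := by positivity
  have hD0 : 0 ≤ D := by positivity
  set G := b₂ + 1 + U with hG
  -- The second bound on δ absorbs the |x̂|² part of δŷ; the third makes its crude bound lose
  -- against c|x̂|² at the barrier level. The bound on α keeps D/α times the error energy below 1.
  -- Each + 1 in a denominator avoids division by zero.
  refine ⟨min 1 (min (c / (2 * H * (L + 1) + 1)) (c ^ 2 / (2 * H ^ 2 * Y ^ 2 * P + 1))),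
    by positivity, D * b₂ + 1, by positivity, L + b₂, c / (2 * P), 2 * (H * G) ^ 2 / c + 1,
    by positivity, by positivity, ?_⟩
  intro δ hδ α hα F h γ T hγ h0 t ht
  have hδ0 : 0 < δ := hδ.1
  have hδ1 : δ ≤ 1 := hδ.2.le.trans (min_le_left _ _)
  have hδ2 : 2 * H * (L + 1) * δ ≤ c := by
    have h1 : δ ≤ c / (2 * H * (L + 1) + 1) :=
      hδ.2.le.trans ((min_le_right _ _).trans (min_le_left _ _))
    rw [le_div_iff₀ (by positivity)] at h1
    linarith
  have hδ3 : 2 * H ^ 2 * Y ^ 2 * P * δ ^ 2 < c ^ 2 := by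
    have h1 : δ ≤ c ^ 2 / (2 * H ^ 2 * Y ^ 2 * P + 1) :=
      hδ.2.le.trans ((min_le_right _ _).trans (min_le_right _ _))
    rw [le_div_iff₀ (by positivity)] at h1
    have h2 : 2 * H ^ 2 * Y ^ 2 * P * δ ^ 2 ≤ 2 * H ^ 2 * Y ^ 2 * P * δ := by
      gcongr; nlinarith
    linarith
  have hα0 : 0 < α := lt_trans (by positivity) (mem_Ioi.1 hα)
  have hDα : D / α * b₂ ≤ 1 := by
    rw [div_mul_eq_mul_div, div_le_one hα0]; linarith [mem_Ioi.1 hα]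
  have he : ∀ t ∈ Ico 0 T, errorEnergy π η (γ t) ≤ b₂ := fun t ht =>
    (h.errorEnergy_le hA hα0.le hγ le_rfl ht.1 ht.2).trans (hB₂' _ h0)
  have hVP : ∀ p : E × W, ‖J (π p.2)‖ ^ 2 ≤ P * ‖π p.2‖ ^ 2 := fun p => by
    have h1 : ‖J (π p.2)‖ ^ 2 ≤ (‖J‖ * ‖π p.2‖) ^ 2 := by gcongr; exact J.le_opNorm _
    rw [mul_pow] at h1
    nlinarith [sq_nonneg ‖π p.2‖]
  have hZV : ∀ p : E × W, ‖π p.2‖ ^ 2 ≤ ‖J (π p.2)‖ ^ 2 := fun p => by gcongr; exact hJ _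
  -- At level L the error part is at most 1, so V ≥ L - 1 ≥ 1 and |x̂|² ≥ 1/P. D is chosen so that
  -- the ε_y² terms cancel exactly, leaving a negative derivative.
  have hWL : ∀ t ∈ Ico 0 T, ‖J (π (γ t).2)‖ ^ 2 + D / α * errorEnergy π η (γ t) ≤ L := by
    refine le_of_deriv_neg_at_level hγ
      (f := fun p => ‖J (π p.2)‖ ^ 2 + D / α * errorEnergy π η p)
      (f' := fun p => 2 * inner ℝ (J (π p.2)) (J (π (F p).2)) +
        D / α * -(2 * α * outputError η p ^ 2))
      (hVc.add (continuous_errorEnergy.const_mul _)) (fun s hs =>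
        (IsObserverLoop.hasDerivWithinAt_lyapunov J (hγ.hasDerivWithinAt_Ici hs)).add
        ((h.hasDerivWithinAt_errorEnergy hA (hγ.hasDerivWithinAt_Ici hs)).const_mul _)) ?_ ?_
    · have h1 : D / α * errorEnergy π η (γ 0) ≤ D / α * b₂ := by
        gcongr; exact hB₂' _ h0
      linarith [hB₀' _ h0]
    · intro s hs hsL
      have h1 : D / α * errorEnergy π η (γ s) ≤ D / α * b₂ := by
        gcongr; exact he s hs
      have h2 : 0 ≤ D / α * errorEnergy π η (γ s) :=
        mul_nonneg (by positivity) (errorEnergy_nonneg _)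
      have h3 := h.lyapunov_deriv_le_of_bounded hc hJc hδ0.le hδ1 hb₂
        ((hZV (γ s)).trans (by linarith : _ ≤ L)) (he s hs)
      rw [← hY, ← hU, ← hH] at h3
      have h4 : 1 ≤ P * ‖π (γ s).2‖ ^ 2 := by linarith [hVP (γ s)]
      have h5 : D / α * -(2 * α * outputError η (γ s) ^ 2) =
          -(2 * H ^ 2 / c * (U ^ 2 * outputError η (γ s) ^ 2)) := by
        rw [hD]; field_simp
      rw [h5]
      have h6 : 2 * H ^ 2 / c * (δ ^ 2 * Y ^ 2) < c * ‖π (γ s).2‖ ^ 2 := by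
        have h7 : c * P * (2 * H ^ 2 / c * (δ ^ 2 * Y ^ 2)) < c * P * (c * ‖π (γ s).2‖ ^ 2) := by
          calc _ = 2 * H ^ 2 * Y ^ 2 * P * δ ^ 2 := by field_simp
            _ < c ^ 2 * 1 := by linarith
            _ ≤ c ^ 2 * (P * ‖π (γ s).2‖ ^ 2) := by gcongr
            _ = _ := by ring
        exact lt_of_mul_lt_mul_left h7 (by positivity)
      linarith
  have hV : ‖J (π (γ t).2)‖ ^ 2 ≤ L := by
    have h2 : 0 ≤ D / α * errorEnergy π η (γ t) :=
      mul_nonneg (by positivity) (errorEnergy_nonneg _)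
    linarith [hWL t ht]
  refine ⟨by linarith, by linarith [he t ht], ?_⟩
  have h3 := h.lyapunov_deriv_le_errorEnergy hc hJc hδ0.le hδ1 hb₂ hδ2
    ((hZV (γ t)).trans hV) (he t ht)
  rw [← hY, ← hU, ← hH, ← hG] at h3
  have h4 : c / (2 * P) * ‖J (π (γ t).2)‖ ^ 2 ≤ c / 2 * ‖π (γ t).2‖ ^ 2 := by
    calc _ ≤ c / (2 * P) * (P * ‖π (γ t).2‖ ^ 2) := by gcongr; exact hVP _
      _ = _ := by field_simp
  linarith [errorEnergy_nonneg (π := π) (η := η) (γ t)]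

end Estimates

/-! ### LaSalle argument and asymptotic stability. -/

section Convergence

variable {E W X X' : Type*} [NormedAddCommGroup E] [InnerProductSpace ℝ E] [FiniteDimensional ℝ E]
  [NormedAddCommGroup W] [InnerProductSpace ℝ W]
  [NormedAddCommGroup X] [InnerProductSpace ℝ X] [NormedAddCommGroup X'] [InnerProductSpace ℝ X']
  {A : E →L[ℝ] E} {b k : E} {δ α : ℝ} {π : W →L[ℝ] E} {η : W →L[ℝ] ℝ}
  {F : E × W → E × W} {J : E →L[ℝ] X} {J' : E →L[ℝ] X'} {c : ℝ}

namespace IsObserverLoop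

/-- A trajectory along which the estimation error has constant energy has no estimation error. -/
lemma errorEnergy_eq_zero_of_const (h : IsObserverLoop A b k δ α π η F)
    (hA : ∀ x, inner ℝ x (A x) = 0) (hAinj : Function.Injective A)
    (hk : ∀ v, v ≠ 0 → inner ℝ k v = 0 → inner ℝ (J v) (J (A v)) ≠ 0)
    (hb : ∀ v, v ≠ 0 → inner ℝ b v = 0 → inner ℝ (J' v) (J' (A v)) ≠ 0)
    (hδ : 0 < δ) (hα : 0 < α) {σ : ℝ → E × W} (hσ : IsGlobalSolution F σ) {ℓ : ℝ}
    (hℓ : ∀ t, 0 ≤ t → errorEnergy π η (σ t) = ℓ) : ℓ = 0 := by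
  have hd : ∀ t, 0 < t → HasDerivWithinAt σ (F (σ t)) univ t := fun t ht =>
    (hσ.hasDerivAt ht).hasDerivWithinAt
  have hpos : ∀ t : ℝ, 0 < t → ∀ᶠ s in 𝓝 t, 0 < s := fun t ht => lt_mem_nhds ht
  have ho : ∀ t, 0 < t → outputError η (σ t) = 0 := fun t ht => by
    have h1 := (h.hasDerivWithinAt_errorEnergy hA (hd t ht)).hasDerivAt univ_mem
    have h2 : HasDerivAt (fun t => errorEnergy π η (σ t)) 0 t :=
      (hasDerivAt_const t ℓ).congr_of_eventuallyEq
        ((hpos t ht).mono fun s hs => hℓ s hs.le)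
    have h3 := h1.unique h2
    simpa [hα.ne'] using h3
  have hub : ∀ t, 0 < t → control k δ π η (σ t) * inner ℝ b (stateError π (σ t)) = 0 :=
    fun t ht => by
    have h1 := (h.hasDerivWithinAt_outputError hA (hd t ht)).hasDerivAt univ_mem
    have h2 : HasDerivAt (fun t => outputError η (σ t)) 0 t :=
      (hasDerivAt_const t 0).congr_of_eventuallyEq ((hpos t ht).mono fun s hs => ho s hs)
    have h3 := h1.unique h2
    rwa [ho t ht, mul_zero, sub_zero] at h3
  have hx : ∀ t, 0 < t →
      HasDerivAt (fun t => stateError π (σ t)) (A (stateError π (σ t))) t := fun t ht => by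
    simpa [ho t ht] using (h.hasDerivWithinAt_stateError (hd t ht)).hasDerivAt univ_mem
  -- If b'ε ≠ 0 at some time, then u vanishes nearby, and this singular control forces the whole
  -- state to be zero at that time.
  have hbx : ∀ t, 0 < t → inner ℝ b (stateError π (σ t)) = 0 := by
    intro s hs
    by_contra hne
    have hcont : ContinuousAt (fun t => inner ℝ b (stateError π (σ t))) s :=
      (continuousAt_const).inner (hx s hs).continuousAt
    have hu : ∀ᶠ t in 𝓝 s, control k δ π η (σ t) = 0 := by
      filter_upwards [hpos s hs, hcont.eventually_ne hne] with t ht hbt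
      exact (mul_eq_zero.1 (hub t ht)).resolve_right hbt
    have hz : ∀ᶠ t in 𝓝 s, HasDerivAt (fun t => π (σ t).2) (A (π (σ t).2)) t := by
      filter_upwards [hpos s hs, hu] with t ht hut
      have := (hasDerivWithinAt_clm_snd π (hd t ht)).hasDerivAt univ_mem
      simpa [h.state, hut] using this
    have hη : ∀ᶠ t in 𝓝 s, HasDerivAt (fun t => η (σ t).2) 0 t := by
      filter_upwards [hpos s hs, hu] with t ht hut
      have := (hasDerivWithinAt_clm_snd η (hd t ht)).hasDerivAt univ_mem
      simpa [h.output, hut, ho t ht] using this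
    have hkA : ∀ᶠ t in 𝓝 s, inner ℝ k (A (π (σ t).2)) = 0 := by
      filter_upwards [hz, hη, hu.eventually_nhds] with t hzt hηt hut
      have h1 : HasDerivAt (fun t => inner ℝ k (π (σ t).2)) (inner ℝ k (A (π (σ t).2))) t :=
        (innerSL ℝ k).hasFDerivAt.comp_hasDerivAt t hzt
      have h2 := (h1.add (hηt.const_mul δ)).unique ((hasDerivAt_const t 0).congr_of_eventuallyEq hut)
      simpa using h2
    -- Observability is applied to Ax̂, not x̂: u = 0 only makes Kx̂ = -δŷ constant, and
    -- differentiating removes the constant.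
    have hAz : A (π (σ s).2) = 0 :=
      eq_zero_of_eventually_inner_eq_zero hA J hk
        (v := fun t => A (π (σ t).2))
        (hz.mono fun t ht => A.hasFDerivAt.comp_hasDerivAt t ht) hkA
    have hz0 : π (σ s).2 = 0 := hAinj (by rw [hAz, A.map_zero])
    have hη0 : η (σ s).2 = 0 := by
      have := hu.self_of_nhds
      simpa [control, hz0, hδ.ne'] using this
    have hx0 : (σ s).1 = 0 := by
      have := ho s hs
      simpa [outputError, hη0] using this
    exact hne (by simp [stateError, hz0, hx0])
  have hx1 : stateError π (σ 1) = 0 :=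
    eq_zero_of_eventually_inner_eq_zero hA J' hb (v := fun t => stateError π (σ t))
      ((hpos 1 one_pos).mono hx) ((hpos 1 one_pos).mono hbx)
  rw [← hℓ 1 zero_le_one, errorEnergy, hx1, ho 1 one_pos]
  simp

lemma tendsto_errorEnergy [FiniteDimensional ℝ W] (h : IsObserverLoop A b k δ α π η F)
    (hA : ∀ x, inner ℝ x (A x) = 0) (hAinj : Function.Injective A)
    (hk : ∀ v, v ≠ 0 → inner ℝ k v = 0 → inner ℝ (J v) (J (A v)) ≠ 0)
    (hb : ∀ v, v ≠ 0 → inner ℝ b v = 0 → inner ℝ (J' v) (J' (A v)) ≠ 0)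
    (hδ : 0 < δ) (hα : 0 < α) {γ : ℝ → E × W} (hγ : IsGlobalSolution F γ) {R : ℝ}
    (hR : ∀ t, 0 ≤ t → ‖γ t‖ ≤ R) :
    Tendsto (fun t => errorEnergy π η (γ t)) atTop (𝓝 0) := by
  -- Freezing the curve before time 0 makes the energy monotone on the whole line.
  have hanti : Antitone fun t => errorEnergy π η (γ (max t 0)) := fun s t hst =>
    h.errorEnergy_le hA hα.le (hγ.isSolutionOn _) (le_max_right _ _)
      (max_le_max_right 0 hst) (lt_add_one _)
  have hlim := (tendsto_atTop_ciInf hanti ⟨0, by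
    rintro _ ⟨t, rfl⟩; exact errorEnergy_nonneg _⟩).congr'
    ((eventually_ge_atTop 0).mono fun t ht => by
      rw [max_eq_left ht])
  set ℓ := ⨅ t, errorEnergy π η (γ (max t 0))
  obtain ⟨σ, τ, hσ, hτ, hconv⟩ := hγ.exists_limit_of_shifts h.contDiff hR
  have hℓ : ℓ = 0 := h.errorEnergy_eq_zero_of_const hA hAinj hk hb hδ hα hσ fun s hs =>
    tendsto_nhds_unique ((continuous_errorEnergy.tendsto _).comp (hconv s hs))
      (hlim.comp (tendsto_atTop_add_const_right _ s hτ))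
  rwa [hℓ] at hlim

end IsObserverLoop

/-- Semi-global stabilization by small perturbation of the feedback and high observer gain. -/
theorem exists_gains_stabilizing [FiniteDimensional ℝ W]
    (hA : ∀ x, inner ℝ x (A x) = 0) (hAinj : Function.Injective A)
    (hc : 0 < c) (hJ : ∀ x, ‖x‖ ≤ ‖J x‖)
    (hJc : ∀ x, inner ℝ (J x) (J (A x + inner ℝ k x • b)) ≤ -c * ‖x‖ ^ 2)
    (hb : ∀ v, v ≠ 0 → inner ℝ b v = 0 → inner ℝ (J' v) (J' (A v)) ≠ 0)
    (π : W →L[ℝ] E) (η : W →L[ℝ] ℝ) (R : ℝ) :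
    ∃ δ₀ > 0, ∃ α₀ > 0, ∀ δ ∈ Ioo 0 δ₀, ∀ α ∈ Ioi α₀, ∀ F : E × W → E × W,
      IsObserverLoop A b k δ α π η F →
        IsAsymptoticallyStable F ∧ Metric.closedBall 0 R ⊆ basin F := by
  -- A positive radius makes the ball a neighbourhood of 0, as local asymptotic stability requires.
  wlog hR1 : 1 ≤ R generalizing R
  · obtain ⟨δ₀, hδ₀, α₀, hα₀, H⟩ := this (max R 1) (le_max_right _ _)
    exact ⟨δ₀, hδ₀, α₀, hα₀, fun δ hδ α hα F hF => ⟨(H δ hδ α hα F hF).1,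
      (Metric.closedBall_subset_closedBall (le_max_left _ _)).trans (H δ hδ α hα F hF).2⟩⟩
  -- On the kernel of K the closed loop coincides with A.
  have hk : ∀ v, v ≠ 0 → inner ℝ k v = 0 → inner ℝ (J v) (J (A v)) ≠ 0 := fun v hv hkv h0 => by
    have := hJc v
    rw [hkv, zero_smul, add_zero, h0] at this
    have hv' : 0 < ‖v‖ := norm_pos_iff.2 hv
    nlinarith [mul_pos hc (pow_pos hv' 2)]
  obtain ⟨δ₀, hδ₀, α₀, hα₀, B, κ, C, hκ, hC, H⟩ :=
    exists_uniform_dissipation hA b k π η hc hJ hJc R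
  refine ⟨δ₀, hδ₀, α₀, hα₀, fun δ hδ α hα F h => ?_⟩
  replace H := H δ hδ α hα F h
  have hδ0 : 0 < δ := hδ.1
  have hα0 : 0 < α := hα₀.trans hα
  have hVc : Continuous fun p : E × W => ‖J (π p.2)‖ ^ 2 := by fun_prop
  have hbd : ∀ (γ : ℝ → E × W) (T : ℝ), IsSolutionOn F γ T → ‖γ 0‖ ≤ R →
      ∀ t ∈ Ico 0 T, ‖γ t‖ ≤ 2 * √B + 2 * B := fun γ T hγ h0 t ht =>
    h.norm_le hJ (H γ T hγ h0 t ht).1 (H γ T hγ h0 t ht).2.1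
  have hbasin : Metric.closedBall 0 R ⊆ basin F := by
    intro p hp
    rw [mem_closedBall_zero_iff] at hp
    obtain ⟨γ, hγ, hγ0, huniq⟩ := isGlobal_of_bounded h.contDiff (p := p)
      fun γ T hγ h0 => hbd γ T hγ (by rwa [h0])
    refine ⟨⟨γ, hγ, hγ0⟩, fun σ T hT hσ h0 => ⟨γ, hγ, huniq σ T hT hσ h0⟩, fun σ hσ h0 => ?_⟩
    have hσ0 : ‖σ 0‖ ≤ R := by rwa [h0]
    have hmem : ∀ t : ℝ, 0 ≤ t → t ∈ Ico 0 (t + 1) := fun t ht => ⟨ht, lt_add_one t⟩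
    have he := h.tendsto_errorEnergy hA hAinj hk hb hδ0 hα0 hσ
      fun t ht => hbd σ _ (hσ.isSolutionOn _) hσ0 t (hmem t ht)
    have hV : Tendsto (fun t => ‖J (π (σ t).2)‖ ^ 2) atTop (𝓝 0) :=
      tendsto_zero_of_deriv_le hκ (fun t => sq_nonneg _)
        (fun t ht => (IsObserverLoop.hasDerivWithinAt_lyapunov J
          (hσ.hasDerivAt ht).hasDerivWithinAt).hasDerivAt univ_mem)
        (fun t ht => (H σ _ (hσ.isSolutionOn _) hσ0 t (hmem t ht.le)).2.2)
        (by simpa using he.const_mul C)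
    have hm : Tendsto (fun t => ‖J (π (σ t).2)‖ ^ 2 + errorEnergy π η (σ t)) atTop (𝓝 0) := by
      simpa using hV.add he
    refine squeeze_zero_norm (fun t => h.norm_le hJ
      (le_add_of_nonneg_right (errorEnergy_nonneg _)) (le_add_of_nonneg_left (sq_nonneg _))) ?_
    have hcont : Continuous fun m : ℝ => 2 * √m + 2 * m := by fun_prop
    simpa [Function.comp_def] using (hcont.tendsto 0).comp hm
  refine ⟨⟨h.map_zero, fun ε hε => ?_,
    mem_of_superset (Metric.closedBall_mem_nhds 0 (by linarith)) hbasin⟩, hbasin⟩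
  obtain ⟨m, hm, hmε⟩ : ∃ m > 0, 2 * √m + 2 * m < ε := by
    have hcont : Continuous fun m : ℝ => 2 * √m + 2 * m := by fun_prop
    have hev : ∀ᶠ m in 𝓝[>] (0 : ℝ), 2 * √m + 2 * m < ε :=
      (hcont.continuousWithinAt.eventually_lt_const (by simpa using hε))
    obtain ⟨m, hm, hm0⟩ := (hev.and self_mem_nhdsWithin).exists
    exact ⟨m, hm0, hm⟩
  have hev : ∀ᶠ p in 𝓝 (0 : E × W), ‖J (π p.2)‖ ^ 2 < m ∧ errorEnergy π η p < m ∧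
      C * errorEnergy π η p < κ * m ∧ ‖p‖ < R := by
    have he0 : errorEnergy π η (0 : E × W) = 0 := by simp [errorEnergy, stateError, outputError]
    refine (hVc.continuousAt.eventually_lt_const (by simpa using hm)).and
      ((continuous_errorEnergy.continuousAt.eventually_lt_const (by rwa [he0])).and
      (((continuous_errorEnergy.const_mul C).continuousAt.eventually_lt_const ?_).and
      (continuous_norm.continuousAt.eventually_lt_const ?_)))
    · simpa [he0] using mul_pos hκ hm
    · simpa using one_pos.trans_le hR1
  obtain ⟨r, hr, hball⟩ := Metric.eventually_nhds_iff_ball.1 hev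
  refine ⟨r, hr, fun γ T hγ h0 t ht => ?_⟩
  obtain ⟨h1, h2, h3, h4⟩ := hball (γ 0) (by simpa using h0)
  have he : ∀ t ∈ Ico 0 T, errorEnergy π η (γ t) ≤ errorEnergy π η (γ 0) := fun t ht =>
    h.errorEnergy_le hA hα0.le hγ le_rfl ht.1 ht.2
  -- At V = m the derivative is at most -κm + C times the initial error energy, negative by the
  -- choice of r.
  have hVm := le_of_deriv_neg_at_level hγ hVc
    (f' := fun p => 2 * inner ℝ (J (π p.2)) (J (π (F p).2)))
    (fun s hs => IsObserverLoop.hasDerivWithinAt_lyapunov J (hγ.hasDerivWithinAt_Ici hs)) h1.le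
    (fun s hs hVs => by
      have h5 := (H γ T hγ h4.le s hs).2.2
      have h6 : C * errorEnergy π η (γ s) ≤ C * errorEnergy π η (γ 0) := by
        gcongr; exact he s hs
      rw [hVs] at h5
      linarith) t ht
  exact (h.norm_le hJ hVm ((he t ht).trans h2.le)).trans_lt hmε

end Convergence

/-! ### The matrix system as an observer loop. -/

section Concrete

variable {n : ℕ}

/-- The first `n` coordinates. -/
noncomputable def initCLM (n : ℕ) : EuclideanSpace ℝ (Fin (n + 1)) →L[ℝ] EuclideanSpace ℝ (Fin n) :=
  LinearMap.toContinuousLinearMap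
    { toFun := fun w => WithLp.toLp 2 fun i => w i.castSucc
      map_add' := fun _ _ => rfl
      map_smul' := fun _ _ => rfl }

lemma initCLM_apply (w : EuclideanSpace ℝ (Fin (n + 1))) (i : Fin n) :
    initCLM n w i = w i.castSucc := rfl

/-- The last coordinate. -/
noncomputable def lastCLM (n : ℕ) : EuclideanSpace ℝ (Fin (n + 1)) →L[ℝ] ℝ :=
  EuclideanSpace.proj (Fin.last n)

lemma lastCLM_apply (w : EuclideanSpace ℝ (Fin (n + 1))) : lastCLM n w = w (Fin.last n) := rfl

/-- `x ↦ A x` on Euclidean space. -/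
noncomputable def mulVecCLM (A : Matrix (Fin n) (Fin n) ℝ) :
    EuclideanSpace ℝ (Fin n) →L[ℝ] EuclideanSpace ℝ (Fin n) :=
  LinearMap.toContinuousLinearMap
    { toFun := fun x => WithLp.toLp 2 (A.mulVec x.ofLp)
      map_add' := fun x y => by ext i; simp [Matrix.mulVec_add]
      map_smul' := fun a x => by ext i; simp [Matrix.mulVec_smul] }

lemma mulVecCLM_apply (A : Matrix (Fin n) (Fin n) ℝ) (x : EuclideanSpace ℝ (Fin n)) :
    mulVecCLM A x = WithLp.toLp 2 (A.mulVec x.ofLp) := rfl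

lemma inner_toLp (v : Fin n → ℝ) (x : EuclideanSpace ℝ (Fin n)) :
    inner ℝ (WithLp.toLp 2 v) x = v ⬝ᵥ x.ofLp := by
  simp [PiLp.inner_apply, dotProduct, mul_comm]

lemma toLp_add_vecMulVec_mulVec (A : Matrix (Fin n) (Fin n) ℝ) (b k : Fin n → ℝ)
    (x : EuclideanSpace ℝ (Fin n)) :
    WithLp.toLp 2 ((A + Matrix.vecMulVec b k).mulVec x.ofLp) =
      mulVecCLM A x + inner ℝ (WithLp.toLp 2 k) x • WithLp.toLp 2 b := by
  rw [inner_toLp, mulVecCLM_apply, Matrix.add_mulVec, Matrix.vecMulVec_mulVec]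
  ext i
  simp [mul_comm]

lemma inner_mulVecCLM_self {A : Matrix (Fin n) (Fin n) ℝ} (hA : A.transpose = -A)
    (x : EuclideanSpace ℝ (Fin n)) : inner ℝ x (mulVecCLM A x) = 0 := by
  have h1 : x.ofLp ⬝ᵥ A.mulVec x.ofLp = -(x.ofLp ⬝ᵥ A.mulVec x.ofLp) := by
    conv_lhs => rw [Matrix.dotProduct_mulVec, ← Matrix.mulVec_transpose, hA, Matrix.neg_mulVec,
      neg_dotProduct, dotProduct_comm]
  have h2 : inner ℝ x (mulVecCLM A x) = x.ofLp ⬝ᵥ A.mulVec x.ofLp := inner_toLp _ _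
  linarith

lemma closedLoop_isObserverLoop (A : Matrix (Fin n) (Fin n) ℝ) (b K : Fin n → ℝ) (δ α : ℝ) :
    IsObserverLoop (mulVecCLM A) (WithLp.toLp 2 b) (WithLp.toLp 2 K) δ α (initCLM n) (lastCLM n)
      (closedLoop (linSys A b) halfSq (observer A b α) (feedback K δ)) := by
  have hu : ∀ p : EuclideanSpace ℝ (Fin n) × EuclideanSpace ℝ (Fin (n + 1)),
      feedback K δ p.2 (halfSq p.1) =
        control (WithLp.toLp 2 K) δ (initCLM n) (lastCLM n) p := fun p => by
    simp [feedback, control, inner_toLp, appendLast, dotProduct, Fin.sum_univ_castSucc,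
      initCLM_apply, lastCLM_apply]
  have h1 : ∀ p, (closedLoop (linSys A b) halfSq (observer A b α) (feedback K δ) p).1 =
      mulVecCLM A p.1 + control (WithLp.toLp 2 K) δ (initCLM n) (lastCLM n) p • WithLp.toLp 2 b :=
    fun p => by rw [← hu]; rfl
  have h2 : ∀ p, initCLM n (closedLoop (linSys A b) halfSq (observer A b α) (feedback K δ) p).2 =
      mulVecCLM A (initCLM n p.2) +
      (control (WithLp.toLp 2 K) δ (initCLM n) (lastCLM n) p -
        control (WithLp.toLp 2 K) δ (initCLM n) (lastCLM n) p * outputError (lastCLM n) p) •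
        WithLp.toLp 2 b := fun p => by
    rw [← hu]
    ext i
    simp [closedLoop, observer, initCLM_apply, mulVecCLM_apply, bilinMat, appendLast,
      Matrix.mulVec, dotProduct, Fin.sum_univ_castSucc, outputError, lastCLM_apply, halfSq]
    ring
  have h3 : ∀ p, lastCLM n (closedLoop (linSys A b) halfSq (observer A b α) (feedback K δ) p).2 =
      control (WithLp.toLp 2 K) δ (initCLM n) (lastCLM n) p *
        inner ℝ (WithLp.toLp 2 b) (initCLM n p.2) - α * outputError (lastCLM n) p := fun p => by
    rw [← hu, inner_toLp]
    simp [closedLoop, observer, initCLM_apply, bilinMat, appendLast,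
      Matrix.mulVec, dotProduct, Fin.sum_univ_castSucc, outputError, lastCLM_apply, halfSq,
      Finset.mul_sum]
    ring_nf
  refine ⟨?_, fun w => ?_, h1, h2, h3⟩
  · have hu' : ContDiff ℝ 1 (control (WithLp.toLp 2 K) δ (initCLM n) (lastCLM n)) := by
      unfold control
      exact (((innerSL ℝ (WithLp.toLp 2 K)).contDiff.comp (initCLM n).contDiff).comp
        contDiff_snd).add (by fun_prop)
    have ho' : ContDiff ℝ 1 (outputError (E := EuclideanSpace ℝ (Fin n)) (lastCLM n)) := by
      unfold outputError
      exact ((lastCLM n).contDiff.comp contDiff_snd).sub ((contDiff_fst.norm_sq ℝ).div_const 2)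
    rw [contDiff_prod_iff]
    simp only [Function.comp_def]
    constructor
    · simp_rw [h1]; fun_prop
    · rw [contDiff_euclidean]
      intro i
      induction i using Fin.lastCases with
      | last =>
        have hb' : ContDiff ℝ 1 fun p : EuclideanSpace ℝ (Fin n) × EuclideanSpace ℝ (Fin (n + 1)) =>
            inner ℝ (WithLp.toLp 2 b) (initCLM n p.2) :=
          ((innerSL ℝ (WithLp.toLp 2 b)).contDiff.comp (initCLM n).contDiff).comp contDiff_snd
        simp_rw [← lastCLM_apply, h3]
        fun_prop
      | cast i =>
        simp_rw [← initCLM_apply, h2]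
        exact contDiff_euclidean.1 (by fun_prop) i
  · rw [EuclideanSpace.real_norm_sq_eq, EuclideanSpace.real_norm_sq_eq, Fin.sum_univ_castSucc]
    rfl

/-- Semi-global stabilization by the perturbed feedback and the Luenberger observer. -/
theorem exists_gains_closedLoop {A : Matrix (Fin n) (Fin n) ℝ} {b K : Fin n → ℝ}
    (hskew : A.transpose = -A) (hinv : IsUnit A) (hK : IsHurwitz (A + Matrix.vecMulVec b K))
    (R : ℝ) :
    ∃ δ₀ > 0, ∃ α₀ > 0, ∀ δ ∈ Ioo 0 δ₀, ∀ α ∈ Ioi α₀,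
      IsAsymptoticallyStable (closedLoop (linSys A b) halfSq (observer A b α) (feedback K δ)) ∧
      Metric.closedBall 0 R ⊆
        basin (closedLoop (linSys A b) halfSq (observer A b α) (feedback K δ)) := by
  obtain ⟨X, _, _, J, c, hc, hJ, hJc⟩ := hK.exists_lyapunov
  obtain ⟨X', _, _, J', c', hc', -, hJc'⟩ := hK.transpose.exists_lyapunov
  simp_rw [Matrix.transpose_add, Matrix.transpose_vecMulVec, hskew] at hJc'
  simp_rw [toLp_add_vecMulVec_mulVec] at hJc hJc'
  have hinj : Function.Injective (mulVecCLM A) := fun x y hxy =>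
    WithLp.ofLp_injective 2 (Matrix.mulVec_injective_of_isUnit hinv
      (congrArg WithLp.ofLp hxy))
  -- The transpose of A + bK is -A + K'b', which coincides with -A on the kernel of b'.
  have hb : ∀ v, v ≠ 0 → inner ℝ (WithLp.toLp 2 b) v = 0 →
      inner ℝ (J' v) (J' (mulVecCLM A v)) ≠ 0 := fun v hv hbv h0 => by
    have h1 := hJc' v
    have h2 : mulVecCLM (-A) v = -mulVecCLM A v := by
      simp [mulVecCLM_apply, Matrix.neg_mulVec]
    rw [hbv, zero_smul, add_zero, h2, map_neg, inner_neg_right, h0] at h1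
    have hv' : 0 < ‖v‖ := norm_pos_iff.2 hv
    nlinarith [mul_pos hc' (pow_pos hv' 2)]
  obtain ⟨δ₀, hδ₀, α₀, hα₀, H⟩ := exists_gains_stabilizing (inner_mulVecCLM_self hskew) hinj hc hJ
    hJc hb (initCLM n) (lastCLM n) R
  exact ⟨δ₀, hδ₀, α₀, hα₀, fun δ hδ α hα => H δ hδ α hα _ (closedLoop_isObserverLoop A b K δ α)⟩

lemma continuous_observer (A : Matrix (Fin n) (Fin n) ℝ) (b : Fin n → ℝ) (α : ℝ) :
    Continuous fun a : EuclideanSpace ℝ (Fin (n + 1)) × ℝ × ℝ =>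
      observer A b α a.1 a.2.1 a.2.2 := by
  have hb : ∀ c : ℝ, Continuous fun u : ℝ => appendLast (u • b) c := fun c =>
    continuous_pi fun i => by
      induction i using Fin.lastCases with
      | last => simp [appendLast, continuous_const]
      | cast i => simp only [appendLast, Fin.snoc_castSucc, Pi.smul_apply]; fun_prop
  have hM : Continuous fun u : ℝ => bilinMat A b u := by
    refine continuous_pi fun i => ?_
    induction i using Fin.lastCases with
    | last =>
      have h (u : ℝ) : bilinMat A b u (Fin.last n) = appendLast (u • b) 0 := by
        ext j; simp [bilinMat, appendLast]
      simpa only [h] using hb 0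
    | cast i =>
      have h (u : ℝ) : bilinMat A b u i.castSucc = appendLast (A i) 0 := by
        ext j; simp [bilinMat, appendLast]
      simpa only [h] using continuous_const
  have hu : Continuous fun a : EuclideanSpace ℝ (Fin (n + 1)) × ℝ × ℝ => a.2.1 := by fun_prop
  have hw : Continuous fun a : EuclideanSpace ℝ (Fin (n + 1)) × ℝ × ℝ => a.1.ofLp := by fun_prop
  have ho : Continuous fun a : EuclideanSpace ℝ (Fin (n + 1)) × ℝ × ℝ =>
    a.1 (Fin.last n) - a.2.2 := by fun_prop
  exact (PiLp.continuous_toLp 2 _).comp ((((hM.comp hu).matrix_mulVec hw).add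
    (hu.smul continuous_const)).sub (ho.smul ((hb α).comp hu)))

lemma continuous_feedback (K : Fin n → ℝ) (δ : ℝ) :
    Continuous fun a : EuclideanSpace ℝ (Fin (n + 1)) × ℝ => feedback K δ a.1 a.2 := by
  unfold feedback dotProduct
  fun_prop

end Concrete

end OutputStab

theorem mainTheorem1 (n : ℕ) (A : Matrix (Fin n) (Fin n) ℝ) (b : Fin n → ℝ)
    (hskew : A.transpose = -A) (hinv : IsUnit A)
    (hstab : OutputStab.IsStabilizablePair A b) :
    OutputStab.IsSemiGloballyStabilizable (OutputStab.linSys A b) OutputStab.halfSq ∧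
    ∀ K : Fin n → ℝ, OutputStab.IsHurwitz (A + Matrix.vecMulVec b K) →
      ∀ (𝒦 : Set (EuclideanSpace ℝ (Fin n))) (𝒦' : Set (EuclideanSpace ℝ (Fin (n + 1)))),
        IsCompact 𝒦 → IsCompact 𝒦' →
        ∃ δ₀ > 0, ∃ α₀ > 0, ∀ δ ∈ Set.Ioo 0 δ₀, ∀ α ∈ Set.Ioi α₀,
          OutputStab.IsAsymptoticallyStable
            (OutputStab.closedLoop (OutputStab.linSys A b) OutputStab.halfSq
              (OutputStab.observer A b α) (OutputStab.feedback K δ)) ∧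
          𝒦 ×ˢ 𝒦' ⊆ OutputStab.basin
            (OutputStab.closedLoop (OutputStab.linSys A b) OutputStab.halfSq
              (OutputStab.observer A b α) (OutputStab.feedback K δ)) := by
  have main : ∀ K : Fin n → ℝ, OutputStab.IsHurwitz (A + Matrix.vecMulVec b K) →
      ∀ (𝒦 : Set (EuclideanSpace ℝ (Fin n))) (𝒦' : Set (EuclideanSpace ℝ (Fin (n + 1)))),
        IsCompact 𝒦 → IsCompact 𝒦' →
        ∃ δ₀ > 0, ∃ α₀ > 0, ∀ δ ∈ Set.Ioo 0 δ₀, ∀ α ∈ Set.Ioi α₀,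
          OutputStab.IsAsymptoticallyStable
            (OutputStab.closedLoop (OutputStab.linSys A b) OutputStab.halfSq
              (OutputStab.observer A b α) (OutputStab.feedback K δ)) ∧
          𝒦 ×ˢ 𝒦' ⊆ OutputStab.basin
            (OutputStab.closedLoop (OutputStab.linSys A b) OutputStab.halfSq
              (OutputStab.observer A b α) (OutputStab.feedback K δ)) := by
    intro K hK 𝒦 𝒦' h𝒦 h𝒦'
    obtain ⟨R, hR⟩ := (h𝒦.prod h𝒦').isBounded.subset_closedBall 0
    obtain ⟨δ₀, hδ₀, α₀, hα₀, H⟩ := OutputStab.exists_gains_closedLoop hskew hinv hK R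
    exact ⟨δ₀, hδ₀, α₀, hα₀, fun δ hδ α hα => ⟨(H δ hδ α hα).1, hR.trans (H δ hδ α hα).2⟩⟩
  refine ⟨fun 𝒦 h𝒦 => ?_, main⟩
  obtain ⟨K, hK⟩ := hstab
  -- For part (1) it is enough to start the observer at 0.
  obtain ⟨δ₀, hδ₀, α₀, hα₀, H⟩ := main K hK 𝒦 {0} h𝒦 isCompact_singleton
  obtain ⟨h1, h2⟩ := H (δ₀ / 2) ⟨by positivity, by linarith⟩ (α₀ + 1) (by simp)
  exact ⟨n + 1, n.succ_pos, OutputStab.observer A b (α₀ + 1), OutputStab.feedback K (δ₀ / 2), {0},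
    OutputStab.continuous_observer A b _, OutputStab.continuous_feedback K _,
    by simp [OutputStab.feedback], isCompact_singleton, Set.singleton_nonempty _, h1, h2⟩
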